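/- **Setting.** Let $T>0$ and let $\gamma:\mathbb R\to[0,\infty)$ be integrable with $\lambda:=\int_{\mathbb R}\gamma(e)\,de$. Let $(\Omega,\mathcal F,\mathbb P)$ be a probability space with a filtration $(\mathcal F_t)_{t\ge 0}$, and let $\mu(de,dt)$ be a Poisson random measure on $(\mathbb R\setminus\{0\})\times[0,T]$ relative to this filtration (its restriction to times in $[0,t]$ is $\mathcal F_t$-measurable and its restriction to times in $(t,T]$ is independent of $\mathcal F_t$), with compensator $\gamma(e)\,de\,dt$ and compensated measure $\tilde\mu(de,dt)=\mu(de,dt)-\gamma(e)\,de\,dt$. Let $X_0$ be $\mathcal F_0$-measurable and let $X_t=X_0+\int_0^t\int e\,\mu(de,ds)$. Let $\varphi:\mathbb R\to\mathbb R$ and $f:[0,T]\times\mathbb R^2\to\mathbb R$, and let $(Y,U)$ be a solution on $[0,T]$ of $$Y_t=\varphi(X_T)+\int_t^T f(s,X_s,Y_s)\,ds-\int_t^T\!\!\int U_s(e)\,\tilde\mu(de,ds),$$ where $Y$ is adapted and càdlàg with $\mathbb E[\sup_{0\le t\le T}|Y_t|^2]<\infty$, and $U$ is predictable with $\mathbb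 E\int_0^T\!\int U_t(e)^2\gamma(e)\,de\,dt<\infty$. **Regularity.** Assume that $\varphi\in C_b^2(\mathbb R)$ and $f\in C_b^2([0,T]\times\mathbb R^2)$ (all partial derivatives of order at most $2$ are continuous and bounded), with $\varphi$, $f$ and all their derivatives of order at most $2$ bounded by $M$, and that the derivatives $\partial_x^{\alpha_1}\partial_y^{\alpha_2}f$, $\alpha_1+\alpha_2\le 2$, are Lipschitz in $(x,y)$ uniformly in $t\in[0,T]$. **Scheme.** For an integer $N\ge1$ let $\Delta t=T/N$ and $t_n=n\Delta t$. The semi-discrete Crank–Nicolson scheme ($\theta=\tfrac12$) consists of measurable functions $y_N,\dots,y_0:\mathbb R\to\mathbb R$ with $y_N=\varphi$ and, for $0\le n<N$ and all $x\in\mathbb R$, $$y_n(x)=\mathbb E\big[y_{n+1}(X^{x}_{n+1})\big]+\tfrac12\Delta t\,\mathbb E\big[f(t_{n+1},X^{x}_{n+1},y_{n+1}(X^{x}_{n+1}))\big]+\tfrac12\Delta t\,f(t_n,x,y_n(x)),$$ where $X^{x}_{n+1}=x+\int_{t_n}^{t_{n+1}}\int e\,\mu(de,ds)$ and both expectations are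 of integrable random variables. Its approximation of $Y_{t_n}$ is $Y_n:=y_n(X_{t_n})$. **Theorem.** There are constants $C$ and $\delta>0$, depending only on $T$, $\lambda$ and $M$, such that, whenever $\Delta t\le\delta$, the random variable $Y_{t_n}-Y_n$ is integrable and $$\mathbb E\big[|Y_{t_n}-Y_n|\big]\le C(\Delta t)^2\qquad\text{for all } n=0,1,\dots,N.$$ -/

import Mathlib

open MeasureTheory ProbabilityTheory Filter Set Topology
open scoped NNReal ENNReal

noncomputable section

namespace NonlocalBSDE

/-! ### Regularity classes -/

/-- `ψ ∈ C_b^k(D)` with all derivatives of order `0, …, k` bounded by `M`. Derivatives are taken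
within `D`, hence one-sided at the boundary; for a product of intervals this is the same as
continuity and boundedness of all partial derivatives of order at most `k`. -/
def CbWith {E : Type*} [NormedAddCommGroup E] [NormedSpace ℝ E]
    (k : ℕ) (D : Set E) (ψ : E → ℝ) (M : ℝ) : Prop :=
  ContDiffOn ℝ k ψ D ∧ ∀ j : ℕ, j ≤ k → ∀ p ∈ D, ‖iteratedFDerivWithin ℝ j ψ D p‖ ≤ M

/-- All partial derivatives of `f (t, x, y)` in `(x, y)` of order at most `k` are Lipschitz in
`(x, y)`, uniformly in `t ∈ [0, T]`. -/
def UniformLipschitzDerivs (k : ℕ) (T : ℝ) (f : ℝ → ℝ → ℝ → ℝ) : Prop :=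
  ∃ K : ℝ≥0, ∀ j : ℕ, j ≤ k → ∀ t ∈ Icc (0 : ℝ) T,
    LipschitzWith K (iteratedFDeriv ℝ j (fun z : ℝ × ℝ => f t z.1 z.2))

/-! ### Poisson random measures and the forward process -/

/-- The jump measure `λ(de) = γ(e) de`. It does not charge the point `0`, so it may be used on
`ℝ` in place of `ℝ \ {0}`. -/
def jumpMeasure (γ : ℝ → ℝ) : Measure ℝ :=
  volume.withDensity (fun e => ENNReal.ofReal (γ e))

/-- The compensator `λ(de) dt` on `[0, T] × ℝ` (first coordinate time, second coordinate jump). -/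
def compensator (T : ℝ) (γ : ℝ → ℝ) : Measure (ℝ × ℝ) :=
  (volume.restrict (Icc (0 : ℝ) T)).prod (jumpMeasure γ)

/-- `N` is a Poisson random measure with (σ-finite) intensity measure `ν`: the mass of a set of
finite intensity is Poisson distributed, and the masses of disjoint sets are independent. -/
structure IsPoissonRandomMeasure {Ω S : Type*} [MeasurableSpace Ω] [MeasurableSpace S]
    (N : Ω → Measure S) (ν : Measure S) (P : Measure Ω) : Prop where
  measurable : Measurable N
  law : ∀ A : Set S, MeasurableSet A → ν A ≠ ∞ →
    P.map (fun ω => N ω A) =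
      (poissonMeasure (ν A).toNNReal).map (fun k : ℕ => (k : ℝ≥0∞))
  indep : ∀ (k : ℕ) (A : Fin k → Set S), (∀ i, MeasurableSet (A i)) →
    Pairwise (fun i j => Disjoint (A i) (A j)) → iIndepFun (fun i ω => N ω (A i)) P

/-- `N` is a Poisson random measure on `time × jump size` relative to the filtration `ℱ`: its
restriction to `[0, t]` is `ℱ t`-measurable and its restriction to `(t, ∞)` is independent
of `ℱ t`. -/
structure IsPoissonRandomMeasureFor {Ω : Type*} [mΩ : MeasurableSpace Ω]
    (ℱ : Filtration ℝ≥0 mΩ) (N : Ω → Measure (ℝ × ℝ)) (ν : Measure (ℝ × ℝ))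
    (P : Measure Ω) : Prop extends IsPoissonRandomMeasure N ν P where
  adapted : ∀ t : ℝ≥0, Measurable[ℱ t] (fun ω => (N ω).restrict (Iic (t : ℝ) ×ˢ univ))
  indep_future : ∀ t : ℝ≥0,
    Indep (MeasurableSpace.comap (fun ω => (N ω).restrict (Ioi (t : ℝ) ×ˢ univ)) inferInstance)
      (ℱ t) P

/-- `∫_{(s, t]} ∫ e N(de, dr)`, the sum of the jumps in `(s, t]`. -/
def jumpSum {Ω : Type*} (N : Ω → Measure (ℝ × ℝ)) (s t : ℝ) (ω : Ω) : ℝ :=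
  ∫ p in Ioc s t ×ˢ (univ : Set ℝ), p.2 ∂(N ω)

/-- The forward process `X_t = X_0 + ∫_0^t ∫ e N(de, dr)`, a compound Poisson process. -/
def forwardProcess {Ω : Type*} (X₀ : Ω → ℝ) (N : Ω → Measure (ℝ × ℝ)) (t : ℝ) (ω : Ω) : ℝ :=
  X₀ ω + jumpSum N 0 t ω

/-- `∫_s^t ∫ U_r(e) Ñ(de, dr)` with `Ñ(de, dr) = N(de, dr) - γ(e) de dr`. As `γ` is integrable,
almost every `N ω` is a finite sum of unit masses, and for predictable square integrable `U`
the Itô integral is this difference of pathwise integrals. -/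
def compensatedIntegral {Ω : Type*} (γ : ℝ → ℝ) (N : Ω → Measure (ℝ × ℝ))
    (U : ℝ → Ω → ℝ → ℝ) (s t : ℝ) (ω : Ω) : ℝ :=
  (∫ p in Ioc s t ×ˢ (univ : Set ℝ), U p.1 ω p.2 ∂(N ω)) -
    ∫ r in s..t, ∫ e, U r ω e ∂(jumpMeasure γ)

/-! ### The backward equation -/

/-- `g` is right-continuous on `[0, T]` with left limits there. -/
def IsCadlagOn (T : ℝ) (g : ℝ → ℝ) : Prop :=
  ∀ t ∈ Icc (0 : ℝ) T, ContinuousWithinAt g (Icc t T) t ∧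
    (0 < t → ∃ l : ℝ, Tendsto g (𝓝[Ico 0 t] t) (𝓝 l))

/-- `(Y, U) ∈ S² × L²(Ñ)` solves, on `[0, T]`, the backward equation
`Y_t = φ(X_T) + ∫_t^T f(s, X_s, Y_s) ds - ∫_t^T ∫ U_s(e) Ñ(de, ds)`. -/
structure IsBSDESolution {Ω : Type*} [mΩ : MeasurableSpace Ω] (P : Measure Ω)
    (ℱ : Filtration ℝ≥0 mΩ) (N : Ω → Measure (ℝ × ℝ)) (γ : ℝ → ℝ) (T : ℝ)
    (φ : ℝ → ℝ) (f : ℝ → ℝ → ℝ → ℝ) (X : ℝ → Ω → ℝ)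
    (Y : ℝ → Ω → ℝ) (U : ℝ → Ω → ℝ → ℝ) : Prop where
  adapted : ∀ t : ℝ≥0, (t : ℝ) ≤ T → Measurable[ℱ t] (Y t)
  cadlag : ∀ ω, IsCadlagOn T (fun t => Y t ω)
  sup_sq : ∫⁻ ω, (⨆ t ∈ Icc (0 : ℝ) T, ‖Y t ω‖ₑ) ^ 2 ∂P < ∞
  predictable : Measurable[ℱ.predictable.prod (inferInstance : MeasurableSpace ℝ)]
    (fun q : (ℝ≥0 × Ω) × ℝ => U q.1.1 q.1.2 q.2)
  sq_integrable : ∫⁻ ω, (∫⁻ t in Icc (0 : ℝ) T, (∫⁻ e, ‖U t ω e‖ₑ ^ 2 ∂(jumpMeasure γ))) ∂P < ∞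
  equation : ∀ t ∈ Icc (0 : ℝ) T, ∀ᵐ ω ∂P,
    Y t ω = φ (X T ω) + (∫ s in t..T, f s (X s ω) (Y s ω))
      - compensatedIntegral γ N U t T ω

/-! ### The time-discrete scheme -/

/-- The uniform grid `t_n = n T / K`. -/
def gridTime (T : ℝ) (K n : ℕ) : ℝ := n * (T / K)

/-- `y n x` is the value `Y_n` of the semi-discrete `θ`-scheme under the condition `X_{t_n} = x`,
on the uniform grid with `K` steps. Under this condition `X_{t_{n+1}}` is `x` plus the jumps of
the driving measure in `(t_n, t_{n+1}]`, and the conditional expectation is the expectation over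
these jumps. -/
structure IsThetaScheme {Ω : Type*} [MeasurableSpace Ω] (P : Measure Ω)
    (N : Ω → Measure (ℝ × ℝ)) (θ T : ℝ) (φ : ℝ → ℝ) (f : ℝ → ℝ → ℝ → ℝ)
    (K : ℕ) (y : ℕ → ℝ → ℝ) : Prop where
  measurable : ∀ n ≤ K, Measurable (y n)
  terminal : ∀ x, y K x = φ x
  integrable_value : ∀ n < K, ∀ x, Integrable
    (fun ω => y (n + 1) (x + jumpSum N (gridTime T K n) (gridTime T K (n + 1)) ω)) P
  integrable_generator : ∀ n < K, ∀ x, Integrable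
    (fun ω => f (gridTime T K (n + 1))
      (x + jumpSum N (gridTime T K n) (gridTime T K (n + 1)) ω)
      (y (n + 1) (x + jumpSum N (gridTime T K n) (gridTime T K (n + 1)) ω))) P
  step : ∀ n < K, ∀ x,
    y n x =
      (∫ ω, y (n + 1) (x + jumpSum N (gridTime T K n) (gridTime T K (n + 1)) ω) ∂P)
      + (1 - θ) * (T / K) *
        (∫ ω, f (gridTime T K (n + 1))
          (x + jumpSum N (gridTime T K n) (gridTime T K (n + 1)) ω)
          (y (n + 1) (x + jumpSum N (gridTime T K n) (gridTime T K (n + 1)) ω)) ∂P)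
      + θ * (T / K) * f (gridTime T K n) x (y n x)

end NonlocalBSDE

end

open MeasureTheory ProbabilityTheory Filter Set Topology
open scoped NNReal ENNReal BoundedContinuousFunction

namespace NonlocalBSDE

/-! ### Moments of the Poisson distribution -/

/-! Because the jump intensity is finite, the generator `L g (x) = ∫ (g (x + e) - g x) ν(de)` is a
bounded operator on bounded continuous functions. The nonlocal equation `∂_t u + L u + f (t, x, u) =
0`, `u (T, ·) = φ`, is therefore an ordinary differential equation in a Banach space.
`exists_backward_evolution` solves it globally and bounds the solution, its Lipschitz constant in
time and its quadratic Taylor remainder by `T`, `ν(ℝ)` and `M` alone. No derivative in `x` is ever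
taken; `f` is expanded only in `(t, y)`.

Probability enters through the functionals `Φ r v = E[Z v(ξ + jumps in (s, r])]`, with `ξ` and a
weight `|Z| ≤ 1` measurable at time `s`. To first order they evolve by `L`, with error `O((r' -
r)²)`: the first order term is the compensation formula, and the remainder lives on the event of at
least two jumps. This replaces Itô's formula. Differentiating `Φ r (u r)` cancels `L` and gives `Φ s
(u s) = Φ t (u t) + ∫ Φ r (w r) dr`, where `w = f (·, ·, u)`.

The identity is used twice. With `Z` the sign of `Y_t - u (t, X_t)` and the backward equation tested
against the same `Z`, it gives `D t ≤ M ∫_t^T D` for `D t = E|Y_t - u (t, X_t)|`, so `Y_t = u (t,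
X_t)` almost surely (`IsBSDESolution.ae_eq`). With `Z = 1` and `ξ = x` it is an exact one-step
formula whose integral the scheme replaces by the trapezoidal rule. The integrand has a first order
expansion with quadratic remainder, so the local error is `O(Δt³)` uniformly in `x`
(`abs_truncation_le`). A discrete Gronwall argument in the supremum norm sums these errors to
`O(Δt²)`. The resulting bound on `Y_{t_n} - Y_n` holds almost surely, and the claim in mean follows.
-/

lemma succ_mul_poissonMeasure_succ (r : ℝ≥0) (k : ℕ) :
    ((k : ℝ≥0∞) + 1) * poissonMeasure r {k + 1} = r * poissonMeasure r {k} := by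
  rw [poissonMeasure_singleton, poissonMeasure_singleton, ← ENNReal.ofReal_coe_nnreal (p := r),
    ← ENNReal.ofReal_mul (by positivity),
    show (k : ℝ≥0∞) + 1 = ENNReal.ofReal ((k : ℝ) + 1) by
      rw [ENNReal.ofReal_add (by positivity) (by positivity)]; simp,
    ← ENNReal.ofReal_mul (by positivity)]
  congr 1
  rw [Nat.factorial_succ, pow_succ]
  push_cast
  field_simp

lemma tsum_poissonMeasure_singleton (r : ℝ≥0) : ∑' k : ℕ, poissonMeasure r {k} = 1 := by
  have h := lintegral_countable' (μ := poissonMeasure r) (fun _ => (1 : ℝ≥0∞))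
  simpa using h.symm

lemma lintegral_natCast_poissonMeasure (r : ℝ≥0) :
    ∫⁻ k : ℕ, (k : ℝ≥0∞) ∂(poissonMeasure r) = r := by
  rw [lintegral_countable', tsum_eq_zero_add' ENNReal.summable]
  simp only [Nat.cast_zero, zero_mul, zero_add, Nat.cast_add, Nat.cast_one,
    succ_mul_poissonMeasure_succ]
  rw [ENNReal.tsum_mul_left, tsum_poissonMeasure_singleton, mul_one]

/-- For `k ≥ 2` one has `1 + k ≤ 3 k (k - 1)`, and the second factorial moment of the Poisson law is
`r²`, by shifting the index twice. The weight `1 + k` is the one needed for the remainder of the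
jump expansion. -/
lemma lintegral_two_le_poissonMeasure (r : ℝ≥0) :
    ∫⁻ k : ℕ, (if 2 ≤ (k : ℝ≥0∞) then 1 + (k : ℝ≥0∞) else 0) ∂(poissonMeasure r)
      ≤ 3 * (r : ℝ≥0∞) ^ 2 := by
  rw [lintegral_countable', tsum_eq_zero_add' ENNReal.summable,
    tsum_eq_zero_add' ENNReal.summable]
  have h0 : ¬ (2 : ℝ≥0∞) ≤ ((0 : ℕ) : ℝ≥0∞) := by simp
  have h1 : ¬ (2 : ℝ≥0∞) ≤ ((0 + 1 : ℕ) : ℝ≥0∞) := by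
    rw [show (2 : ℝ≥0∞) = ((2 : ℕ) : ℝ≥0∞) by simp, Nat.cast_le]; norm_num
  simp only [h0, h1, if_false, zero_mul, zero_add]
  have hle : ∀ k : ℕ, (if 2 ≤ ((k + 1 + 1 : ℕ) : ℝ≥0∞) then 1 + ((k + 1 + 1 : ℕ) : ℝ≥0∞) else 0) *
      poissonMeasure r {k + 1 + 1} ≤ 3 * (r : ℝ≥0∞) ^ 2 * poissonMeasure r {k} := by
    intro k
    have h2 : (1 + ((k + 1 + 1 : ℕ) : ℝ≥0∞)) ≤
        3 * (((k : ℝ≥0∞) + 1) * (((k + 1 : ℕ) : ℝ≥0∞) + 1)) := by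
      have : (1 + (k + 1 + 1)) ≤ 3 * ((k + 1) * (k + 1 + 1)) := by nlinarith
      exact_mod_cast this
    calc _ ≤ (1 + ((k + 1 + 1 : ℕ) : ℝ≥0∞)) * poissonMeasure r {k + 1 + 1} := by
            gcongr; split_ifs <;> simp
      _ ≤ 3 * (((k : ℝ≥0∞) + 1) * (((k + 1 : ℕ) : ℝ≥0∞) + 1)) * poissonMeasure r {k + 1 + 1} := by
            gcongr
      _ = 3 * ((k : ℝ≥0∞) + 1) * ((((k + 1 : ℕ) : ℝ≥0∞) + 1) * poissonMeasure r {k + 1 + 1}) := by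
            ring
      _ = 3 * r * (((k : ℝ≥0∞) + 1) * poissonMeasure r {k + 1}) := by
            rw [succ_mul_poissonMeasure_succ]; ring
      _ = _ := by rw [succ_mul_poissonMeasure_succ]; ring
  calc _ ≤ ∑' k : ℕ, 3 * (r : ℝ≥0∞) ^ 2 * poissonMeasure r {k} := ENNReal.tsum_le_tsum hle
    _ = _ := by rw [ENNReal.tsum_mul_left, tsum_poissonMeasure_singleton, mul_one]

/-! ### Poisson random measures -/

section PRM

variable {Ω S : Type*} [MeasurableSpace Ω] [MeasurableSpace S]
  {N : Ω → Measure S} {ν : Measure S} {P : Measure Ω}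

namespace IsPoissonRandomMeasure

lemma measurable_apply (hN : IsPoissonRandomMeasure N ν P) {A : Set S} (hA : MeasurableSet A) :
    Measurable (fun ω => N ω A) :=
  (Measure.measurable_coe hA).comp hN.measurable

lemma lintegral_comp_apply (hN : IsPoissonRandomMeasure N ν P) {A : Set S} (hA : MeasurableSet A)
    (hfin : ν A ≠ ∞) {g : ℝ≥0∞ → ℝ≥0∞} (hg : Measurable g) :
    ∫⁻ ω, g (N ω A) ∂P = ∫⁻ k : ℕ, g k ∂(poissonMeasure (ν A).toNNReal) := by
  rw [← lintegral_map hg (hN.measurable_apply hA), hN.law A hA hfin,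
    lintegral_map hg (by fun_prop)]

lemma lintegral_apply (hN : IsPoissonRandomMeasure N ν P) {A : Set S} (hA : MeasurableSet A)
    (hfin : ν A ≠ ∞) : ∫⁻ ω, N ω A ∂P = ν A := by
  refine (hN.lintegral_comp_apply hA hfin measurable_id).trans ?_
  simp only [id_eq]
  rw [lintegral_natCast_poissonMeasure, ENNReal.coe_toNNReal hfin]

lemma lintegral_two_le (hN : IsPoissonRandomMeasure N ν P) {A : Set S} (hA : MeasurableSet A)
    (hfin : ν A ≠ ∞) :
    ∫⁻ ω, (if 2 ≤ N ω A then 1 + N ω A else 0) ∂P ≤ 3 * ν A ^ 2 := by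
  have hg : Measurable (fun x : ℝ≥0∞ => if 2 ≤ x then 1 + x else 0) :=
    Measurable.ite measurableSet_Ici (by fun_prop) measurable_const
  rw [hN.lintegral_comp_apply hA hfin hg]
  refine (lintegral_two_le_poissonMeasure _).trans ?_
  rw [ENNReal.coe_toNNReal hfin]

lemma ae_natCast (hN : IsPoissonRandomMeasure N ν P) {A : Set S} (hA : MeasurableSet A)
    (hfin : ν A ≠ ∞) : ∀ᵐ ω ∂P, ∃ k : ℕ, N ω A = k := by
  have hr : MeasurableSet (range (fun k : ℕ => (k : ℝ≥0∞))) := (countable_range _).measurableSet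
  have h : ∀ᵐ x ∂(P.map (fun ω => N ω A)), x ∈ range (fun k : ℕ => (k : ℝ≥0∞)) := by
    rw [hN.law A hA hfin]
    exact (ae_map_iff (f := fun k : ℕ => (k : ℝ≥0∞)) (by fun_prop) hr).2
      (Eventually.of_forall fun k => ⟨k, rfl⟩)
  have := (ae_map_iff (hN.measurable_apply hA).aemeasurable hr).1 h
  filter_upwards [this] with ω ⟨k, hk⟩
  exact ⟨k, hk.symm⟩

/-- Integer masses and Markov's inequality bound the probability that `A n` is charged by `ν (A n)`,
which tends to zero by continuity from above. -/
lemma ae_forall_mem_of_measure_compl (hN : IsPoissonRandomMeasure N ν P) {A : ℕ → Set S}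
    (hA : ∀ n, MeasurableSet (A n)) (hanti : Antitone A) (hfin : ν (A 0) ≠ ∞)
    (hinter : ⋂ n, A n = ∅) : ∀ᵐ ω ∂P, ∃ n, N ω (A n) = 0 := by
  have hfin' : ∀ n, ν (A n) ≠ ∞ := fun n =>
    ne_top_of_le_ne_top hfin (measure_mono (hanti n.zero_le))
  have hlim : Tendsto (fun n => ν (A n)) atTop (𝓝 0) := by
    have := tendsto_measure_iInter_atTop (μ := ν) (s := A) (fun n => (hA n).nullMeasurableSet)
      hanti ⟨0, hfin⟩
    rwa [hinter, measure_empty] at this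
  have hle : ∀ n, P {ω | ∀ n, N ω (A n) ≠ 0} ≤ ν (A n) := by
    intro n
    calc P {ω | ∀ n, N ω (A n) ≠ 0} ≤ P {ω | 1 ≤ N ω (A n)} := by
          refine measure_mono_ae ?_
          filter_upwards [hN.ae_natCast (hA n) (hfin' n)] with ω ⟨k, hk⟩ h
          have hne : N ω (A n) ≠ 0 := h n
          change 1 ≤ N ω (A n)
          rw [hk] at hne ⊢
          exact_mod_cast Nat.one_le_iff_ne_zero.2 (by simpa using hne)
      _ ≤ ∫⁻ ω, N ω (A n) ∂P := by
          have := mul_meas_ge_le_lintegral (μ := P) (hN.measurable_apply (hA n)) 1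
          simpa using this
      _ = ν (A n) := hN.lintegral_apply (hA n) (hfin' n)
  have : P {ω | ∀ n, N ω (A n) ≠ 0} = 0 :=
    le_antisymm (ge_of_tendsto hlim (Eventually.of_forall hle)) zero_le
  rw [ae_iff]
  simpa using this

/-- An `s`-finite version of a Poisson random measure with finite intensity. -/
noncomputable def kernel (hN : IsPoissonRandomMeasure N ν P) : Kernel Ω S :=
  -- Sorting `ω` by the integer total mass makes each piece a finite kernel, so the sum is s-finite;
  -- where the mass is not an integer the kernel is zero.
  open Classical in
  Kernel.sum fun n : ℕ => Kernel.piecewise (s := {ω | N ω univ = n})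
    (measurableSet_eq_fun (hN.measurable_apply MeasurableSet.univ) measurable_const)
    ⟨N, hN.measurable⟩ 0

instance (hN : IsPoissonRandomMeasure N ν P) : IsSFiniteKernel hN.kernel := by
  classical
  unfold kernel
  have : ∀ n : ℕ, IsFiniteKernel (Kernel.piecewise (s := {ω | N ω univ = n})
    (measurableSet_eq_fun (hN.measurable_apply MeasurableSet.univ) measurable_const)
    (⟨N, hN.measurable⟩ : Kernel Ω S) 0) := by
    intro n
    refine ⟨⟨n, by simp, fun ω => ?_⟩⟩
    rw [Kernel.piecewise_apply]
    split_ifs with h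
    · exact le_of_eq h
    · simp
  infer_instance

lemma kernel_apply_of_eq (hN : IsPoissonRandomMeasure N ν P) {ω : Ω} {k : ℕ}
    (h : N ω univ = k) : hN.kernel ω = N ω := by
  classical
  unfold kernel
  ext A hA
  rw [Kernel.sum_apply' _ _ hA, tsum_eq_single k]
  · rw [Kernel.piecewise_apply, if_pos (show ω ∈ {ω | N ω univ = k} from h)]; rfl
  · intro n hn
    rw [Kernel.piecewise_apply, if_neg]
    · simp
    · intro h'
      have h2 : N ω univ = n := h'
      exact hn (by rw [h] at h2; exact_mod_cast h2.symm)

lemma ae_kernel_eq (hN : IsPoissonRandomMeasure N ν P) [IsFiniteMeasure ν] :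
    ∀ᵐ ω ∂P, hN.kernel ω = N ω := by
  filter_upwards [hN.ae_natCast MeasurableSet.univ (measure_ne_top ν _)] with ω ⟨k, hk⟩
  exact hN.kernel_apply_of_eq hk

lemma ae_isFiniteMeasure (hN : IsPoissonRandomMeasure N ν P) [IsFiniteMeasure ν] :
    ∀ᵐ ω ∂P, IsFiniteMeasure (N ω) := by
  filter_upwards [hN.ae_natCast MeasurableSet.univ (measure_ne_top ν _)] with ω ⟨k, hk⟩
  exact ⟨by rw [hk]; simp⟩

lemma compProd_kernel_apply (hN : IsPoissonRandomMeasure N ν P) [IsFiniteMeasure ν] [SFinite P]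
    {s : Set (Ω × S)} (hs : MeasurableSet s) :
    (P ⊗ₘ hN.kernel) s = ∫⁻ ω, N ω (Prod.mk ω ⁻¹' s) ∂P := by
  rw [Measure.compProd_apply hs]
  refine lintegral_congr_ae ?_
  filter_upwards [hN.ae_kernel_eq] with ω hω
  rw [hω]

end IsPoissonRandomMeasure

end PRM

/-- A probability measure on `ℝ` that gives each half-line `(-∞, q]`, `q` rational, an integer mass
is a Dirac mass. -/
lemma exists_eq_dirac_of_natCast {m : Measure ℝ} (h1 : m univ = 1)
    (hq : ∀ q : ℚ, ∃ k : ℕ, m (Iic (q : ℝ)) = k) : ∃ e, m = Measure.dirac e := by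
  have : IsProbabilityMeasure m := ⟨h1⟩
  have : IsZeroOneMeasure m := by
    refine ⟨fun s hs => ?_⟩
    -- Being of mass `0` or `1` survives complements and disjoint unions, so it is enough to check
    -- the π-system of rational half-lines.
    induction s, hs using MeasurableSpace.induction_on_inter
      ((BorelSpace.measurable_eq (α := ℝ)).trans Real.borel_eq_generateFrom_Iic_rat)
      Real.isPiSystem_Iic_rat with
    | empty => simp
    | basic s hs =>
      simp only [mem_iUnion, mem_singleton_iff] at hs
      obtain ⟨q, rfl⟩ := hs
      obtain ⟨k, hk⟩ := hq q
      have : m (Iic (q : ℝ)) ≤ 1 := prob_le_one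
      rw [hk] at this ⊢
      have hk1 : k ≤ 1 := by exact_mod_cast this
      interval_cases k <;> simp
    | compl s hs ih =>
      rw [prob_compl_eq_one_sub hs]
      rcases ih with h | h <;> simp [h]
    | iUnion s hd hs ih =>
      by_cases h : ∀ n, m (s n) = 0
      · left; exact measure_iUnion_null h
      · push Not at h
        obtain ⟨n, hn⟩ := h
        right
        refine le_antisymm prob_le_one ?_
        rw [← (ih n).resolve_left hn]
        exact measure_mono (subset_iUnion s n)
  exact IsZeroOneMeasure.exists_eq_dirac

/-! ### The compensation formula -/

/-- The σ-algebra on the target is left free here and in the next two lemmas, so that it can be the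
predictable one instead of the product instance. -/
lemma map_eq_map_of_piSystem {α S : Type*} [MeasurableSpace α] [mS : MeasurableSpace S]
    {μ₁ μ₂ : Measure α} [IsFiniteMeasure μ₁] {Φ : α → S} (hΦ : Measurable Φ) {C : Set (Set S)}
    (hgen : mS = MeasurableSpace.generateFrom C) (hC : IsPiSystem C)
    (h : ∀ s ∈ C, μ₁ (Φ ⁻¹' s) = μ₂ (Φ ⁻¹' s)) (huniv : μ₁ univ = μ₂ univ) :
    μ₁.map Φ = μ₂.map Φ := by
  refine ext_of_generate_finite C hgen hC (fun s hs => ?_) ?_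
  · have hs' : MeasurableSet s := by rw [hgen]; exact MeasurableSpace.measurableSet_generateFrom hs
    rw [Measure.map_apply hΦ hs', Measure.map_apply hΦ hs', h s hs]
  · rw [Measure.map_apply hΦ .univ, Measure.map_apply hΦ .univ, preimage_univ, huniv]

lemma lintegral_comp_eq_of_map_eq {α S : Type*} [MeasurableSpace α] [MeasurableSpace S]
    {μ₁ μ₂ : Measure α} {Φ : α → S} (hΦ : Measurable Φ) (h : μ₁.map Φ = μ₂.map Φ)
    {H : S → ℝ≥0∞} (hH : Measurable H) : ∫⁻ a, H (Φ a) ∂μ₁ = ∫⁻ a, H (Φ a) ∂μ₂ := by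
  rw [← lintegral_map hH hΦ, h, lintegral_map hH hΦ]

lemma integral_comp_eq_of_map_eq {α S : Type*} [MeasurableSpace α] [MeasurableSpace S]
    {μ₁ μ₂ : Measure α} {Φ : α → S} (hΦ : Measurable Φ) (h : μ₁.map Φ = μ₂.map Φ)
    {H : S → ℝ} (hH : Measurable H) : ∫ a, H (Φ a) ∂μ₁ = ∫ a, H (Φ a) ∂μ₂ := by
  rw [← integral_map hΦ.aemeasurable hH.aestronglyMeasurable, h,
    integral_map hΦ.aemeasurable hH.aestronglyMeasurable]

/-- The generating rectangles of the predictable `σ`-algebra. -/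
def predictableRect {Ω : Type*} [mΩ : MeasurableSpace Ω] (ℱ : Filtration ℝ≥0 mΩ) :
    Set (Set (ℝ≥0 × Ω)) :=
  {s | ∃ A, MeasurableSet[ℱ ⊥] A ∧ s = {⊥} ×ˢ A} ∪
    {s | ∃ i A, MeasurableSet[ℱ i] A ∧ s = Set.Ioi i ×ˢ A}

section Predictable

variable {Ω : Type*} [mΩ : MeasurableSpace Ω] {ℱ : Filtration ℝ≥0 mΩ}

lemma isPiSystem_predictableRect : IsPiSystem (predictableRect ℱ) := by
  rintro s (⟨A, hA, rfl⟩ | ⟨i, A, hA, rfl⟩) t (⟨B, hB, rfl⟩ | ⟨j, B, hB, rfl⟩) hst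
  · exact Or.inl ⟨A ∩ B, hA.inter hB, by rw [prod_inter_prod, inter_self]⟩
  · exfalso
    obtain ⟨⟨r, ω⟩, ⟨h1, -⟩, ⟨h2, -⟩⟩ := hst
    rw [mem_singleton_iff.1 h1] at h2
    exact not_lt_bot (mem_Ioi.1 h2)
  · exfalso
    obtain ⟨⟨r, ω⟩, ⟨h1, -⟩, ⟨h2, -⟩⟩ := hst
    rw [mem_singleton_iff.1 h2] at h1
    exact not_lt_bot (mem_Ioi.1 h1)
  · refine Or.inr ⟨max i j, A ∩ B, (ℱ.mono (le_max_left i j) _ hA).inter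
      (ℱ.mono (le_max_right i j) _ hB), ?_⟩
    rw [prod_inter_prod, Ioi_inter_Ioi]

lemma isCountablySpanning_predictableRect : IsCountablySpanning (predictableRect ℱ) := by
  refine ⟨fun n => if n = 0 then {⊥} ×ˢ univ else Ioi ⊥ ×ˢ univ, fun n => ?_, ?_⟩
  · dsimp only
    split_ifs
    · exact Or.inl ⟨univ, MeasurableSet.univ, rfl⟩
    · exact Or.inr ⟨⊥, univ, MeasurableSet.univ, rfl⟩
  · refine eq_univ_of_forall fun ⟨r, ω⟩ => ?_
    rw [mem_iUnion]
    rcases eq_or_ne r ⊥ with h | h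
    · exact ⟨0, by simp [h]⟩
    · exact ⟨1, by simpa using pos_iff_ne_zero.2 h⟩

lemma predictable_prod_eq_generateFrom :
    ℱ.predictable.prod (inferInstance : MeasurableSpace ℝ) =
      MeasurableSpace.generateFrom
        (image2 (· ×ˢ ·) (predictableRect ℱ) {s : Set ℝ | MeasurableSet s}) := by
  have h := @generateFrom_prod_eq _ _ (predictableRect ℱ) {s : Set ℝ | MeasurableSet s}
    isCountablySpanning_predictableRect isCountablySpanning_measurableSet
  rw [MeasurableSpace.generateFrom_measurableSet] at h
  exact h

lemma isPiSystem_predictableRect_prod :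
    IsPiSystem (image2 (· ×ˢ ·) (predictableRect ℱ) {s : Set ℝ | MeasurableSet s}) :=
  isPiSystem_predictableRect.prod MeasurableSpace.isPiSystem_measurableSet

lemma predictable_le : ℱ.predictable ≤ (inferInstance : MeasurableSpace (ℝ≥0 × Ω)) := by
  refine measurableSpace_le_predictable_of_measurableSet (fun A hA => ?_) (fun i A hA => ?_)
  · exact (measurableSet_singleton _).prod (ℱ.le _ _ hA)
  · exact measurableSet_Ioi.prod (ℱ.le _ _ hA)

/-- A sample point together with a marked time, as a point of the predictable space. -/
def toPredictable (q : Ω × (ℝ × ℝ)) : (ℝ≥0 × Ω) × ℝ := ((q.2.1.toNNReal, q.1), q.2.2)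

lemma measurable_toPredictable_full : Measurable (toPredictable (Ω := Ω)) := by
  unfold toPredictable
  fun_prop

lemma measurable_toPredictable :
    Measurable[_, ℱ.predictable.prod (inferInstance : MeasurableSpace ℝ)]
      (toPredictable (Ω := Ω)) := by
  refine Measurable.mono measurable_toPredictable_full le_rfl ?_
  exact sup_le_sup (MeasurableSpace.comap_mono predictable_le) le_rfl

/-- A process that vanishes up to time `s` and is `ℱ s`-measurable and constant afterwards is
predictable. -/
lemma measurable_predictable_indicator {s : ℝ≥0} {Z : Ω → ℝ} (hZ : Measurable[ℱ s] Z) :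
    Measurable[ℱ.predictable] (fun q : ℝ≥0 × Ω => (Ioi s).indicator (fun _ => Z q.2) q.1) := by
  intro B hB
  have hI : MeasurableSet[ℱ.predictable] (Ioi s ×ˢ (univ : Set Ω)) :=
    measurableSet_predictable_Ioi_prod MeasurableSet.univ
  have hA : MeasurableSet[ℱ.predictable] (Ioi s ×ˢ (Z ⁻¹' B)) :=
    measurableSet_predictable_Ioi_prod (hZ hB)
  by_cases h0 : (0 : ℝ) ∈ B
  · convert hA.union hI.compl using 1
    ext ⟨r, ω⟩
    by_cases hr : s < r <;> simp [indicator, hr, h0]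
  · convert hA using 1
    ext ⟨r, ω⟩
    by_cases hr : s < r <;> simp [indicator, hr, h0]

end Predictable

section Compensation

lemma measurable_comap_restrict_Ioi_apply {Ω : Type*} {N : Ω → Measure (ℝ × ℝ)}
    (s : ℝ) {A : Set (ℝ × ℝ)} (hA : MeasurableSet A) (hAs : A ⊆ Ioi s ×ˢ univ) :
    Measurable[MeasurableSpace.comap (fun ω => (N ω).restrict (Ioi s ×ˢ univ)) inferInstance]
      (fun ω => N ω A) := by
  have : (fun ω => N ω A) = (fun m : Measure (ℝ × ℝ) => m A) ∘
      (fun ω => (N ω).restrict (Ioi s ×ˢ univ)) := by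
    ext ω
    simp only [Function.comp]
    rw [Measure.restrict_apply hA, inter_eq_left.2 hAs]
  rw [this]
  exact (Measure.measurable_coe hA).comp (comap_measurable _)

/-- The intensity `ν(de) dt` on `[0, T] × ℝ`. -/
noncomputable abbrev timeJump (T : ℝ) (ν : Measure ℝ) : Measure (ℝ × ℝ) :=
  (volume.restrict (Icc (0 : ℝ) T)).prod ν

variable {Ω : Type*} [mΩ : MeasurableSpace Ω] {P : Measure Ω} [IsProbabilityMeasure P]
  {ℱ : Filtration ℝ≥0 mΩ} {N : Ω → Measure (ℝ × ℝ)} {T : ℝ} {ν : Measure ℝ} [IsFiniteMeasure ν]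

lemma timeJump_Ioc_prod {s t : ℝ} (hs : 0 ≤ s) (ht : t ≤ T) (B : Set ℝ) :
    timeJump T ν (Ioc s t ×ˢ B) = ENNReal.ofReal (t - s) * ν B := by
  rw [Measure.prod_prod, Measure.restrict_apply measurableSet_Ioc,
    inter_eq_left.2 (show Ioc s t ⊆ Icc 0 T from fun r hr => ⟨hs.trans hr.1.le, hr.2.trans ht⟩),
    Real.volume_Ioc]

lemma measurable_measure_restrict {S : Type*} [MeasurableSpace S] {A : Set S}
    (hA : MeasurableSet A) : Measurable (fun m : Measure S => m.restrict A) := by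
  refine Measure.measurable_of_measurable_coe _ fun B hB => ?_
  simp only [Measure.restrict_apply hB]
  exact Measure.measurable_coe (hB.inter hA)

lemma timeJump_Iic_zero : timeJump T ν (Iic 0 ×ˢ univ) = 0 := by
  rw [Measure.prod_prod, Measure.restrict_apply measurableSet_Iic]
  have : volume (Iic (0 : ℝ) ∩ Icc 0 T) = 0 := by
    refine measure_mono_null (t := {0}) (fun r hr => ?_) (by simp)
    exact le_antisymm hr.1 hr.2.1
  rw [this, zero_mul]

/-- The mean measure of a Poisson random measure and its compensator agree on the predictable
`σ`-algebra. -/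
lemma IsPoissonRandomMeasureFor.map_toPredictable
    (hN : IsPoissonRandomMeasureFor ℱ N (timeJump T ν) P) :
    @Measure.map _ _ _ (ℱ.predictable.prod (inferInstance : MeasurableSpace ℝ)) toPredictable
        (P ⊗ₘ hN.toIsPoissonRandomMeasure.kernel) =
      @Measure.map _ _ _ (ℱ.predictable.prod (inferInstance : MeasurableSpace ℝ)) toPredictable
        (P.prod (timeJump T ν)) := by
  have hN' := hN.toIsPoissonRandomMeasure
  have huniv : (P ⊗ₘ hN'.kernel) univ = (P.prod (timeJump T ν)) univ := by
    rw [hN'.compProd_kernel_apply .univ]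
    simp only [preimage_univ]
    rw [hN'.lintegral_apply .univ (measure_ne_top _ _),
      show (univ : Set (Ω × (ℝ × ℝ))) = univ ×ˢ univ from univ_prod_univ.symm, Measure.prod_prod,
      measure_univ (μ := P), one_mul]
  have : IsFiniteMeasure (P ⊗ₘ hN'.kernel) := ⟨by rw [huniv]; exact measure_lt_top _ _⟩
  refine @map_eq_map_of_piSystem _ _ _ (ℱ.predictable.prod (inferInstance : MeasurableSpace ℝ)) _ _
    _ _ measurable_toPredictable _ predictable_prod_eq_generateFrom
    isPiSystem_predictableRect_prod ?_ huniv
  rintro _ ⟨_, (⟨A, hA, rfl⟩ | ⟨i, A, hA, rfl⟩), B, hB, rfl⟩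
  -- `Real.toNNReal` collapses all times `≤ 0` to the initial instant; neither measure charges them.
  · have hsub : toPredictable ⁻¹' (({⊥} ×ˢ A) ×ˢ B) ⊆ (univ : Set Ω) ×ˢ (Iic (0 : ℝ) ×ˢ univ) := by
      rintro ⟨ω, r, e⟩ ⟨⟨hr, -⟩, -⟩
      refine ⟨trivial, ?_, trivial⟩
      exact Real.toNNReal_eq_zero.1 hr
    have h1 : (P ⊗ₘ hN'.kernel) ((univ : Set Ω) ×ˢ (Iic (0 : ℝ) ×ˢ univ)) = 0 := by
      have hm : MeasurableSet (Iic (0 : ℝ) ×ˢ (univ : Set ℝ)) := measurableSet_Iic.prod .univ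
      rw [hN'.compProd_kernel_apply (MeasurableSet.univ.prod hm)]
      have : ∀ ω : Ω, Prod.mk ω ⁻¹' ((univ : Set Ω) ×ˢ (Iic (0 : ℝ) ×ˢ (univ : Set ℝ))) =
          Iic (0 : ℝ) ×ˢ univ := by intro ω; ext; simp
      simp only [this]
      rw [hN'.lintegral_apply hm (measure_ne_top _ _), timeJump_Iic_zero]
    have h2 : (P.prod (timeJump T ν)) ((univ : Set Ω) ×ˢ (Iic (0 : ℝ) ×ˢ univ)) = 0 := by
      rw [Measure.prod_prod, timeJump_Iic_zero, mul_zero]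
    change (P ⊗ₘ hN'.kernel) (toPredictable ⁻¹' (({⊥} ×ˢ A) ×ˢ B)) =
      (P.prod (timeJump T ν)) (toPredictable ⁻¹' (({⊥} ×ˢ A) ×ˢ B))
    rw [measure_mono_null hsub h1, measure_mono_null hsub h2]
  · have heq : toPredictable ⁻¹' ((Ioi i ×ˢ A) ×ˢ B) = A ×ˢ (Ioi (i : ℝ) ×ˢ B) := by
      ext ⟨ω, r, e⟩
      simp only [toPredictable, mem_preimage, mem_prod, mem_Ioi, Real.lt_toNNReal_iff_coe_lt]
      tauto
    have hm : MeasurableSet (Ioi (i : ℝ) ×ˢ B) := measurableSet_Ioi.prod hB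
    change (P ⊗ₘ hN'.kernel) (toPredictable ⁻¹' ((Ioi i ×ˢ A) ×ˢ B)) =
      (P.prod (timeJump T ν)) (toPredictable ⁻¹' ((Ioi i ×ˢ A) ×ˢ B))
    rw [heq, hN'.compProd_kernel_apply ((ℱ.le _ _ hA).prod hm), Measure.prod_prod]
    have hpre : ∀ ω, N ω (Prod.mk ω ⁻¹' (A ×ˢ (Ioi (i : ℝ) ×ˢ B))) =
        N ω (Ioi (i : ℝ) ×ˢ B) * A.indicator (fun _ => 1) ω := by
      intro ω
      by_cases hω : ω ∈ A
      · simp [hω]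
      · simp [hω]
    simp only [hpre]
    -- The mass after time `i` is independent of `A ∈ ℱ i`, so the mean factorises into intensity
    -- times probability.
    rw [lintegral_mul_eq_lintegral_mul_lintegral_of_independent_measurableSpace
      (Measurable.comap_le ((measurable_measure_restrict
        (measurableSet_Ioi.prod MeasurableSet.univ)).comp hN'.measurable)) (ℱ.le i)
      (hN.indep_future i)
      (measurable_comap_restrict_Ioi_apply _ hm
        (prod_mono_right (subset_univ _)))
      ((@measurable_const _ _ _ (ℱ i) _).indicator hA),
      hN'.lintegral_apply hm (measure_ne_top _ _), lintegral_indicator_const (ℱ.le _ _ hA),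
      one_mul, mul_comm]

end Compensation

section Compensation

variable {Ω : Type*} [mΩ : MeasurableSpace Ω] {P : Measure Ω} [IsProbabilityMeasure P]
  {ℱ : Filtration ℝ≥0 mΩ} {N : Ω → Measure (ℝ × ℝ)} {T : ℝ} {ν : Measure ℝ} [IsFiniteMeasure ν]

/-- The compensation formula: integrals of a predictable process against a Poisson random measure
and against its compensator have the same mean on every `ℱ s`-measurable event. -/
lemma IsPoissonRandomMeasureFor.integral_mul_setIntegral
    (hN : IsPoissonRandomMeasureFor ℱ N (timeJump T ν) P) {H : ℝ → Ω → ℝ → ℝ}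
    (hH : Measurable[ℱ.predictable.prod (inferInstance : MeasurableSpace ℝ)]
      (fun q : (ℝ≥0 × Ω) × ℝ => H q.1.1 q.1.2 q.2))
    (hint : ∫⁻ ω, (∫⁻ r in Icc (0 : ℝ) T, (∫⁻ e, ‖H r ω e‖ₑ ∂ν)) ∂P < ∞)
    {s t : ℝ≥0} (hst : s ≤ t) (htT : (t : ℝ) ≤ T) {Z : Ω → ℝ} (hZ : Measurable[ℱ s] Z)
    (hZb : ∀ ω, |Z ω| ≤ 1) :
    Integrable (fun ω => Z ω * ∫ p in Ioc (s : ℝ) t ×ˢ (univ : Set ℝ), H p.1 ω p.2 ∂(N ω)) P ∧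
    Integrable (fun ω => Z ω * ∫ r in (s : ℝ)..t, ∫ e, H r ω e ∂ν) P ∧
    ∫ ω, Z ω * (∫ p in Ioc (s : ℝ) t ×ˢ (univ : Set ℝ), H p.1 ω p.2 ∂(N ω)) ∂P =
      ∫ ω, Z ω * (∫ r in (s : ℝ)..t, ∫ e, H r ω e ∂ν) ∂P := by
  have hN' := hN.toIsPoissonRandomMeasure
  have hmS : MeasurableSet (Ioc (s : ℝ) t ×ˢ (univ : Set ℝ)) := measurableSet_Ioc.prod .univ
  -- The weight `Z` on `(s, t]` is the difference of two predictable step processes, switched on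
  -- after `s` and after `t`.
  set G : (ℝ≥0 × Ω) × ℝ → ℝ := fun q => ((Ioi s).indicator (fun _ => Z q.1.2) q.1.1 -
    (Ioi t).indicator (fun _ => Z q.1.2) q.1.1) * H q.1.1 q.1.2 q.2 with hGdef
  have hG : Measurable[ℱ.predictable.prod (inferInstance : MeasurableSpace ℝ)] G := by
    have h1 : Measurable[ℱ.predictable] (fun q : ℝ≥0 × Ω => (Ioi s).indicator (fun _ => Z q.2) q.1 -
        (Ioi t).indicator (fun _ => Z q.2) q.1) :=
      (measurable_predictable_indicator hZ).sub
        (measurable_predictable_indicator (hZ.mono (ℱ.mono hst) le_rfl))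
    exact (h1.comp (@measurable_fst _ _ ℱ.predictable _)).mul hH
  have hGΦ : ∀ q : Ω × (ℝ × ℝ), G (toPredictable q) =
      (Ioc (s : ℝ) t ×ˢ (univ : Set ℝ)).indicator (fun p => Z q.1 * H p.1 q.1 p.2) q.2 := by
    rintro ⟨ω, r, e⟩
    simp only [hGdef, toPredictable, indicator, mem_Ioi, Real.lt_toNNReal_iff_coe_lt, mem_prod,
      mem_Ioc, mem_univ, and_true]
    by_cases h1 : (s : ℝ) < r
    · have hr : ((r.toNNReal : ℝ≥0) : ℝ) = r := Real.coe_toNNReal _ (s.2.trans h1.le)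
      rw [hr]
      by_cases h2 : (t : ℝ) < r
      · simp [h1, h2, h2.not_ge]
      · simp [h1, h2, not_lt.1 h2]
    · have h2 : ¬ (t : ℝ) < r := fun h => h1 (lt_of_le_of_lt (by exact_mod_cast hst) h)
      simp [h1, h2]
  have hGm : Measurable (fun q : Ω × (ℝ × ℝ) => G (toPredictable q)) :=
    hG.comp measurable_toPredictable
  have hle : ∀ q : Ω × (ℝ × ℝ), ‖G (toPredictable q)‖ₑ ≤ ‖H q.2.1 q.1 q.2.2‖ₑ := by
    intro q
    rw [hGΦ, indicator]
    split_ifs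
    · rw [enorm_mul]
      calc _ ≤ 1 * ‖H q.2.1 q.1 q.2.2‖ₑ := by
            gcongr
            rw [← ofReal_norm]
            exact ENNReal.ofReal_le_one.2 (hZb _)
        _ = _ := one_mul _
    · simp
  have hfin : ∫⁻ q, ‖G (toPredictable q)‖ₑ ∂(P.prod (timeJump T ν)) < ∞ := by
    rw [lintegral_prod _ hGm.enorm.aemeasurable]
    refine lt_of_le_of_lt (lintegral_mono fun ω => ?_) hint
    have hm : Measurable (fun p : ℝ × ℝ => ‖G (toPredictable (ω, p))‖ₑ) :=
      (hGm.comp measurable_prodMk_left).enorm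
    rw [lintegral_prod _ hm.aemeasurable]
    exact lintegral_mono fun r => lintegral_mono fun e => hle _
  have hmap := hN.map_toPredictable
  have hI2 : Integrable (fun q => G (toPredictable q)) (P.prod (timeJump T ν)) :=
    ⟨hGm.aestronglyMeasurable, hfin⟩
  have hI1 : Integrable (fun q => G (toPredictable q)) (P ⊗ₘ hN'.kernel) := by
    refine ⟨hGm.aestronglyMeasurable, ?_⟩
    -- Integrability against the random measure is inherited from the compensator, since the two
    -- pushforwards agree on nonnegative predictable integrands.
    have := @lintegral_comp_eq_of_map_eq _ _ _
      (ℱ.predictable.prod (inferInstance : MeasurableSpace ℝ))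
      _ _ _ measurable_toPredictable hmap (fun q => ‖G q‖ₑ) (measurable_enorm.comp hG)
    change _ < _
    rw [this]
    exact hfin
  have heq := @integral_comp_eq_of_map_eq _ _ _
    (ℱ.predictable.prod (inferInstance : MeasurableSpace ℝ)) _ _ _ measurable_toPredictable
    hmap _ hG
  have e1 : (fun ω => ∫ p, G (toPredictable (ω, p)) ∂(hN'.kernel ω)) =ᵐ[P]
      fun ω => Z ω * ∫ p in Ioc (s : ℝ) t ×ˢ (univ : Set ℝ), H p.1 ω p.2 ∂(N ω) := by
    filter_upwards [hN'.ae_kernel_eq] with ω hω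
    simp only [hω, hGΦ]
    rw [integral_indicator hmS, integral_const_mul]
  have e2 : (fun ω => ∫ p, G (toPredictable (ω, p)) ∂(timeJump T ν)) =ᵐ[P]
      fun ω => Z ω * ∫ r in (s : ℝ)..t, ∫ e, H r ω e ∂ν := by
    filter_upwards [hI2.prod_right_ae] with ω hω
    rw [integral_prod _ hω]
    simp only [hGΦ]
    rw [intervalIntegral.integral_of_le (by exact_mod_cast hst), ← integral_const_mul]
    have : ∀ r, (∫ e, (Ioc (s : ℝ) t ×ˢ (univ : Set ℝ)).indicator
        (fun p => Z ω * H p.1 ω p.2) (r, e) ∂ν) =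
        (Ioc (s : ℝ) t).indicator (fun r => Z ω * ∫ e, H r ω e ∂ν) r := by
      intro r
      by_cases hr : r ∈ Ioc (s : ℝ) t
      · simp [indicator, hr, integral_const_mul]
      · simp only [indicator, mem_prod, hr, false_and, if_false, integral_zero]
    simp only [this]
    rw [integral_indicator measurableSet_Ioc, Measure.restrict_restrict measurableSet_Ioc,
      inter_eq_left.2 (show Ioc (s : ℝ) t ⊆ Icc 0 T from
        fun r hr => ⟨s.2.trans hr.1.le, hr.2.trans htT⟩)]
  refine ⟨hI1.integral_compProd.congr e1, hI2.integral_prod_left.congr e2, ?_⟩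
  rw [← integral_congr_ae e1, ← integral_congr_ae e2, ← Measure.integral_compProd hI1,
    ← integral_prod _ hI2]
  exact heq

end Compensation

/-! ### The generator of the forward process -/

section Generator

variable (ν : Measure ℝ) [IsFiniteMeasure ν]

lemma integrable_comp_add (g : ℝ →ᵇ ℝ) (x : ℝ) : Integrable (fun e => g (x + e)) ν :=
  Integrable.of_bound (g.continuous.comp (continuous_const.add continuous_id)).aestronglyMeasurable
    ‖g‖ (Eventually.of_forall fun _ => g.norm_coe_le_norm _)

lemma integrable_comp_add_sub (g : ℝ →ᵇ ℝ) (x : ℝ) : Integrable (fun e => g (x + e) - g x) ν :=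
  (integrable_comp_add ν g x).sub (integrable_const _)

lemma abs_sub_le_two_mul_norm (g : ℝ →ᵇ ℝ) (x y : ℝ) : ‖g x - g y‖ ≤ 2 * ‖g‖ := by
  have h1 := g.norm_coe_le_norm x
  have h2 := g.norm_coe_le_norm y
  have h3 := norm_sub_le (g x) (g y)
  linarith

lemma norm_integral_jump_le (g : ℝ →ᵇ ℝ) (x : ℝ) :
    ‖∫ e, (g (x + e) - g x) ∂ν‖ ≤ 2 * ν.real univ * ‖g‖ := by
  have := norm_integral_le_of_norm_le_const (μ := ν) (f := fun e => g (x + e) - g x)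
    (C := 2 * ‖g‖) (Eventually.of_forall fun e => abs_sub_le_two_mul_norm g _ _)
  linarith

/-- The generator `g ↦ ∫ (g (x + e) - g x) ν(de)` of a compound Poisson process, as a bounded
operator on bounded continuous functions. -/
noncomputable def jumpGenerator : (ℝ →ᵇ ℝ) →L[ℝ] (ℝ →ᵇ ℝ) :=
  LinearMap.mkContinuous
    { toFun := fun g => BoundedContinuousFunction.ofNormedAddCommGroup
        (fun x => ∫ e, (g (x + e) - g x) ∂ν)
        (continuous_of_dominated (bound := fun _ => 2 * ‖g‖)
          (fun x => ((g.continuous.comp (continuous_const.add continuous_id)).sub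
            continuous_const).aestronglyMeasurable)
          (fun x => Eventually.of_forall fun e => abs_sub_le_two_mul_norm g _ _)
          (integrable_const _)
          (Eventually.of_forall fun e => (g.continuous.comp
            (continuous_id.add continuous_const)).sub g.continuous))
        (2 * ν.real univ * ‖g‖) (norm_integral_jump_le ν g)
      map_add' := fun g h => by
        ext x
        simp only [BoundedContinuousFunction.coe_ofNormedAddCommGroup,
          BoundedContinuousFunction.coe_add, Pi.add_apply]
        rw [← integral_add (integrable_comp_add_sub ν g x) (integrable_comp_add_sub ν h x)]
        exact integral_congr_ae (Eventually.of_forall fun e => by simp only; ring)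
      map_smul' := fun c g => by
        ext x
        simp only [BoundedContinuousFunction.coe_ofNormedAddCommGroup,
          BoundedContinuousFunction.coe_smul, smul_eq_mul, RingHom.id_apply]
        rw [← integral_const_mul]
        exact integral_congr_ae (Eventually.of_forall fun e => by simp only; ring) }
    (2 * ν.real univ) (fun g => BoundedContinuousFunction.norm_ofNormedAddCommGroup_le _
      (by positivity) (norm_integral_jump_le ν g))

lemma jumpGenerator_apply (g : ℝ →ᵇ ℝ) (x : ℝ) :
    jumpGenerator ν g x = ∫ e, (g (x + e) - g x) ∂ν := rfl

lemma norm_jumpGenerator_le : ‖jumpGenerator ν‖ ≤ 2 * ν.real univ :=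
  LinearMap.mkContinuous_norm_le _ (by positivity) fun g =>
    BoundedContinuousFunction.norm_ofNormedAddCommGroup_le _ (by positivity)
      (norm_integral_jump_le ν g)

end Generator

/-! ### The jump sums -/

/-- Lower integrals are measurable in the measure. The Bochner integral is a difference of two of
them where `g` is integrable, and its default value `0` elsewhere, so no finiteness of `m` is
needed. -/
lemma measurable_integral_measure {S : Type*} [MeasurableSpace S] {g : S → ℝ} (hg : Measurable g) :
    Measurable (fun m : Measure S => ∫ p, g p ∂m) := by
  classical
  have h : (fun m : Measure S => ∫ p, g p ∂m) = fun m => if ∫⁻ p, ‖g p‖ₑ ∂m < ∞ then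
      (∫⁻ p, ENNReal.ofReal (g p) ∂m).toReal - (∫⁻ p, ENNReal.ofReal (-g p) ∂m).toReal else 0 := by
    ext m
    split_ifs with h
    · exact integral_eq_lintegral_pos_part_sub_lintegral_neg_part ⟨hg.aestronglyMeasurable, h⟩
    · exact integral_undef fun hi => h hi.2
  rw [h]
  refine Measurable.ite (measurableSet_lt (Measure.measurable_lintegral hg.enorm) measurable_const)
    ?_ measurable_const
  exact (Measure.measurable_lintegral hg.ennreal_ofReal).ennreal_toReal.sub
    (Measure.measurable_lintegral hg.neg.ennreal_ofReal).ennreal_toReal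

section JumpSum

variable {Ω : Type*} [mΩ : MeasurableSpace Ω] {P : Measure Ω} [IsProbabilityMeasure P]
  {ℱ : Filtration ℝ≥0 mΩ} {N : Ω → Measure (ℝ × ℝ)} {T : ℝ} {ν : Measure ℝ} [IsFiniteMeasure ν]

omit mΩ in
lemma jumpSum_self (s : ℝ) (ω : Ω) : jumpSum N s s ω = 0 := by
  simp [jumpSum]

omit mΩ in
lemma jumpSum_add {ω : Ω} (hω : Integrable (fun p : ℝ × ℝ => p.2) (N ω)) {r s t : ℝ} (hrs : r ≤ s)
    (hst : s ≤ t) : jumpSum N r s ω + jumpSum N s t ω = jumpSum N r t ω := by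
  unfold jumpSum
  rw [← setIntegral_union _ (measurableSet_Ioc.prod .univ) hω.integrableOn hω.integrableOn,
    ← union_prod, Ioc_union_Ioc_eq_Ioc hrs hst]
  exact Disjoint.set_prod_left (Ioc_disjoint_Ioc_of_le le_rfl) _ _

namespace IsPoissonRandomMeasureFor

omit [IsProbabilityMeasure P] [IsFiniteMeasure ν] in
lemma measurable_jumpSum (hN : IsPoissonRandomMeasureFor ℱ N (timeJump T ν) P)
    (s : ℝ) (t : ℝ≥0) : Measurable[ℱ t] (jumpSum N s t) := by
  have h : jumpSum N s t = (fun m : Measure (ℝ × ℝ) => ∫ p, p.2 ∂m) ∘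
      (fun m : Measure (ℝ × ℝ) => m.restrict (Ioc s t ×ˢ univ)) ∘
      (fun ω => (N ω).restrict (Iic (t : ℝ) ×ˢ univ)) := by
    ext ω
    simp only [jumpSum, Function.comp]
    rw [Measure.restrict_restrict (measurableSet_Ioc.prod .univ), inter_eq_left.2
      (prod_mono_left fun r hr => hr.2)]
  rw [h]
  exact (measurable_integral_measure measurable_snd).comp
    ((measurable_measure_restrict (measurableSet_Ioc.prod .univ)).comp (hN.adapted t))

-- No moment of the jump law is assumed. Almost every `N ω` is finite and, since the intensity of
-- `{|e| > n}` tends to zero, charges only jumps of bounded size.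
omit [IsProbabilityMeasure P] in
lemma ae_integrable_snd (hN : IsPoissonRandomMeasureFor ℱ N (timeJump T ν) P) :
    ∀ᵐ ω ∂P, Integrable (fun p : ℝ × ℝ => p.2) (N ω) := by
  have hN' := hN.toIsPoissonRandomMeasure
  have h := hN'.ae_forall_mem_of_measure_compl (A := fun n : ℕ => {p : ℝ × ℝ | (n : ℝ) < |p.2|})
    (fun n => measurableSet_lt measurable_const (by fun_prop))
    (fun m n hmn p (hp : (n : ℝ) < |p.2|) => lt_of_le_of_lt (Nat.cast_le.2 hmn) hp)
    (measure_ne_top _ _)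
    (by
      refine eq_empty_of_forall_notMem fun p hp => ?_
      obtain ⟨n, hn⟩ := exists_nat_ge |p.2|
      exact absurd (mem_iInter.1 hp n) (not_lt.2 hn))
  filter_upwards [h, hN'.ae_isFiniteMeasure] with ω ⟨n, hn⟩ hfin
  refine Integrable.of_bound measurable_snd.aestronglyMeasurable (n : ℝ) ?_
  rw [ae_iff]
  convert hn using 2
  ext p
  simp

omit [IsProbabilityMeasure P] in
lemma ae_jumpSum_add (hN : IsPoissonRandomMeasureFor ℱ N (timeJump T ν) P) {r s t : ℝ}
    (hrs : r ≤ s) (hst : s ≤ t) :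
    ∀ᵐ ω ∂P, jumpSum N r s ω + jumpSum N s t ω = jumpSum N r t ω := by
  filter_upwards [hN.ae_integrable_snd] with ω hω
  exact jumpSum_add hω hrs hst

omit [IsProbabilityMeasure P] in
/-- If exactly one jump occurs in `(s, t]` then integrals over the jumps evaluate at its size. -/
lemma ae_exists_jump (hN : IsPoissonRandomMeasureFor ℱ N (timeJump T ν) P) (s t : ℝ) :
    ∀ᵐ ω ∂P, N ω (Ioc s t ×ˢ univ) = 1 → ∃ e : ℝ, ∀ g : ℝ → ℝ, Measurable g →
      ∫ p in Ioc s t ×ˢ (univ : Set ℝ), g p.2 ∂(N ω) = g e := by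
  have hN' := hN.toIsPoissonRandomMeasure
  have h : ∀ᵐ ω ∂P, ∀ q : ℚ, ∃ k : ℕ, N ω (Ioc s t ×ˢ Iic (q : ℝ)) = k :=
    ae_all_iff.2 fun q => hN'.ae_natCast (measurableSet_Ioc.prod measurableSet_Iic)
      (measure_ne_top _ _)
  filter_upwards [h] with ω hω h1
  have hm : MeasurableSet (Ioc s t ×ˢ (univ : Set ℝ)) := measurableSet_Ioc.prod .univ
  obtain ⟨e, he⟩ := exists_eq_dirac_of_natCast
    (m := ((N ω).restrict (Ioc s t ×ˢ univ)).map Prod.snd)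
    (by rw [Measure.map_apply measurable_snd .univ, preimage_univ, Measure.restrict_apply_univ, h1])
    (fun q => by
      obtain ⟨k, hk⟩ := hω q
      refine ⟨k, ?_⟩
      rw [Measure.map_apply measurable_snd measurableSet_Iic,
        Measure.restrict_apply (measurable_snd measurableSet_Iic), ← hk]
      congr 1
      ext ⟨a, b⟩
      simp [and_comm])
  refine ⟨e, fun g hg => ?_⟩
  rw [← integral_map measurable_snd.aemeasurable hg.aestronglyMeasurable, he, integral_dirac]

omit [IsProbabilityMeasure P] in
/-- The second order remainder in the expansion of `v (ξ + ∑ jumps)`. -/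
lemma ae_enorm_remainder_le (hN : IsPoissonRandomMeasureFor ℱ N (timeJump T ν) P) (s t : ℝ)
    (ξ : Ω → ℝ) (v : ℝ →ᵇ ℝ) :
    ∀ᵐ ω ∂P, ‖v (ξ ω + jumpSum N s t ω) - v (ξ ω)
        - ∫ p in Ioc s t ×ˢ (univ : Set ℝ), (v (ξ ω + p.2) - v (ξ ω)) ∂(N ω)‖ₑ
      ≤ ENNReal.ofReal (2 * ‖v‖) *
        (if 2 ≤ N ω (Ioc s t ×ˢ univ) then 1 + N ω (Ioc s t ×ˢ univ) else 0) := by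
  have hN' := hN.toIsPoissonRandomMeasure
  have hm : MeasurableSet (Ioc s t ×ˢ (univ : Set ℝ)) := measurableSet_Ioc.prod .univ
  filter_upwards [hN'.ae_natCast hm (measure_ne_top _ _), hN.ae_exists_jump s t,
    hN'.ae_isFiniteMeasure] with ω ⟨k, hk⟩ hjump hfin
  -- With no jump both terms vanish and with one jump they coincide; with `k ≥ 2` jumps the crude
  -- bound is `2 ‖v‖ (1 + k)`.
  rcases Nat.lt_or_ge k 2 with hk2 | hk2
  · have hzero : v (ξ ω + jumpSum N s t ω) - v (ξ ω)
        - ∫ p in Ioc s t ×ˢ (univ : Set ℝ), (v (ξ ω + p.2) - v (ξ ω)) ∂(N ω) = 0 := by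
      interval_cases k
      · have h0 : (N ω).restrict (Ioc s t ×ˢ univ) = 0 :=
          Measure.restrict_eq_zero.2 (by simpa using hk)
        simp [jumpSum, h0]
      · obtain ⟨e, he⟩ := hjump (by simpa using hk)
        have h1 : jumpSum N s t ω = e := he id measurable_id
        rw [h1, he (fun y => v (ξ ω + y) - v (ξ ω)) (by
          have := v.continuous.measurable
          fun_prop)]
        ring
    rw [hzero]
    simp
  · have hle : (2 : ℝ≥0∞) ≤ N ω (Ioc s t ×ˢ univ) := by
      rw [hk]; exact_mod_cast hk2
    rw [if_pos hle, hk, ← ofReal_norm, show (1 : ℝ≥0∞) + k = ENNReal.ofReal (1 + k) by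
      rw [ENNReal.ofReal_add (by norm_num) (by positivity)]; simp,
      ← ENNReal.ofReal_mul (by positivity)]
    refine ENNReal.ofReal_le_ofReal ?_
    have h1 := norm_setIntegral_le_of_norm_le_const (μ := N ω) (s := Ioc s t ×ˢ (univ : Set ℝ))
      (f := fun p => v (ξ ω + p.2) - v (ξ ω)) (measure_lt_top _ _)
      (fun p _ => abs_sub_le_two_mul_norm v _ _)
    rw [measureReal_def, hk, ENNReal.toReal_natCast] at h1
    have h2 := abs_sub_le_two_mul_norm v (ξ ω + jumpSum N s t ω) (ξ ω)
    have h3 := norm_sub_le (v (ξ ω + jumpSum N s t ω) - v (ξ ω))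
      (∫ p in Ioc s t ×ˢ (univ : Set ℝ), (v (ξ ω + p.2) - v (ξ ω)) ∂(N ω))
    linarith

/-- This is the compensation formula for an integrand frozen at time `s`: its compensator is
constant in time, which produces the generator at `ξ`. -/
lemma integral_mul_jump_integral (hN : IsPoissonRandomMeasureFor ℱ N (timeJump T ν) P)
    {s t : ℝ≥0} (hst : s ≤ t) (htT : (t : ℝ) ≤ T) {ξ Z : Ω → ℝ} (hξ : Measurable[ℱ s] ξ)
    (hZ : Measurable[ℱ s] Z) (hZb : ∀ ω, |Z ω| ≤ 1) (v : ℝ →ᵇ ℝ) :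
    Integrable (fun ω => Z ω * ∫ p in Ioc (s : ℝ) t ×ˢ (univ : Set ℝ),
      (v (ξ ω + p.2) - v (ξ ω)) ∂(N ω)) P ∧
    ∫ ω, Z ω * (∫ p in Ioc (s : ℝ) t ×ˢ (univ : Set ℝ), (v (ξ ω + p.2) - v (ξ ω)) ∂(N ω)) ∂P =
      ∫ ω, Z ω * ((t - s : ℝ) * jumpGenerator ν v (ξ ω)) ∂P := by
  have hst' : (s : ℝ) ≤ t := by exact_mod_cast hst
  -- The value `ξ` is known only at time `s`, so it is switched on after `s` to obtain a predictable
  -- process; on `(s, t]` nothing changes.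
  set ξ' : ℝ → Ω → ℝ := fun r ω => (Ioi (s : ℝ)).indicator (fun _ => ξ ω) r with hξ'
  have hpred : Measurable[ℱ.predictable.prod (inferInstance : MeasurableSpace ℝ)]
      (fun q : (ℝ≥0 × Ω) × ℝ => v (ξ' q.1.1 q.1.2 + q.2) - v (ξ' q.1.1 q.1.2)) := by
    have h1 : Measurable[ℱ.predictable] (fun q : ℝ≥0 × Ω => ξ' q.1 q.2) := by
      have : (fun q : ℝ≥0 × Ω => ξ' q.1 q.2) =
          fun q : ℝ≥0 × Ω => (Ioi s).indicator (fun _ => ξ q.2) q.1 := by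
        ext q
        simp [hξ', indicator]
      rw [this]
      exact measurable_predictable_indicator hξ
    have h2 : Measurable[ℱ.predictable.prod (inferInstance : MeasurableSpace ℝ)]
        (fun q : (ℝ≥0 × Ω) × ℝ => ξ' q.1.1 q.1.2) := h1.comp (@measurable_fst _ _ ℱ.predictable _)
    have h3 : Measurable[ℱ.predictable.prod (inferInstance : MeasurableSpace ℝ)]
        (fun q : (ℝ≥0 × Ω) × ℝ => q.2) := @measurable_snd _ _ ℱ.predictable _
    exact (v.continuous.measurable.comp (h2.add h3)).sub (v.continuous.measurable.comp h2)
  have hint : ∫⁻ ω, (∫⁻ r in Icc (0 : ℝ) T, (∫⁻ e, ‖v (ξ' r ω + e) - v (ξ' r ω)‖ₑ ∂ν)) ∂P < ∞ := by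
    calc _ ≤ ∫⁻ ω, (∫⁻ r in Icc (0 : ℝ) T, (∫⁻ e, ENNReal.ofReal (2 * ‖v‖) ∂ν)) ∂P := by
          refine lintegral_mono fun ω => lintegral_mono fun r => lintegral_mono fun e => ?_
          rw [← ofReal_norm]
          exact ENNReal.ofReal_le_ofReal (abs_sub_le_two_mul_norm v _ _)
      _ < ∞ := by
          simp only [lintegral_const, measure_univ, mul_one]
          exact ENNReal.mul_lt_top (ENNReal.mul_lt_top ENNReal.ofReal_lt_top (measure_lt_top _ _))
            (measure_lt_top _ _)
  obtain ⟨h1, -, h3⟩ := hN.integral_mul_setIntegral (H := fun r ω e => v (ξ' r ω + e) - v (ξ' r ω))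
    hpred hint hst htT hZ hZb
  have e1 : ∀ ω, ∫ p in Ioc (s : ℝ) t ×ˢ (univ : Set ℝ),
      (v (ξ' p.1 ω + p.2) - v (ξ' p.1 ω)) ∂(N ω) = ∫ p in Ioc (s : ℝ) t ×ˢ (univ : Set ℝ),
      (v (ξ ω + p.2) - v (ξ ω)) ∂(N ω) := by
    intro ω
    refine setIntegral_congr_fun (measurableSet_Ioc.prod .univ) fun p hp => ?_
    have : ξ' p.1 ω = ξ ω := indicator_of_mem (show p.1 ∈ Ioi (s : ℝ) from hp.1.1) _
    simp only [this]
  have e2 : ∀ ω, ∫ r in (s : ℝ)..t, ∫ e, (v (ξ' r ω + e) - v (ξ' r ω)) ∂ν =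
      (t - s : ℝ) * jumpGenerator ν v (ξ ω) := by
    intro ω
    rw [intervalIntegral.integral_of_le hst',
      setIntegral_congr_fun (g := fun _ => jumpGenerator ν v (ξ ω))
      measurableSet_Ioc fun r hr => ?_]
    · rw [setIntegral_const, measureReal_def, Real.volume_Ioc,
        ENNReal.toReal_ofReal (sub_nonneg.2 hst'), smul_eq_mul]
    · have : ξ' r ω = ξ ω := indicator_of_mem (show r ∈ Ioi (s : ℝ) from hr.1) _
      simp only [this, jumpGenerator_apply]
  simp only [e1, e2] at h1 h3
  exact ⟨h1, h3⟩

omit [IsFiniteMeasure ν] in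
lemma integrable_mul_comp {Z ξ : Ω → ℝ} (hZ : Measurable Z) (hξ : Measurable ξ)
    (hZb : ∀ ω, |Z ω| ≤ 1) (v : ℝ →ᵇ ℝ) : Integrable (fun ω => Z ω * v (ξ ω)) P := by
  refine Integrable.of_bound (hZ.mul (v.continuous.measurable.comp hξ)).aestronglyMeasurable ‖v‖
    (Eventually.of_forall fun ω => ?_)
  rw [norm_mul]
  calc _ ≤ 1 * ‖v‖ := mul_le_mul (hZb ω) (v.norm_coe_le_norm _) (norm_nonneg _) zero_le_one
    _ = ‖v‖ := one_mul _

/-- Short time expansion of the transition operators of the forward process. -/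
lemma abs_integral_comp_add_jumpSum_sub_le
    (hN : IsPoissonRandomMeasureFor ℱ N (timeJump T ν) P)
    {s t : ℝ≥0} (hst : s ≤ t) (htT : (t : ℝ) ≤ T) {ξ Z : Ω → ℝ} (hξ : Measurable[ℱ s] ξ)
    (hZ : Measurable[ℱ s] Z) (hZb : ∀ ω, |Z ω| ≤ 1) (v : ℝ →ᵇ ℝ) :
    |∫ ω, Z ω * v (ξ ω + jumpSum N s t ω) ∂P
      - ∫ ω, Z ω * (v + (t - s : ℝ) • jumpGenerator ν v) (ξ ω) ∂P|
      ≤ 6 * ν.real univ ^ 2 * (t - s) ^ 2 * ‖v‖ := by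
  have hst' : (s : ℝ) ≤ t := by exact_mod_cast hst
  have hZ' := hZ.mono (ℱ.le s) le_rfl
  have hξ' := hξ.mono (ℱ.le s) le_rfl
  have hJ : Measurable (jumpSum N (s : ℝ) t) := (hN.measurable_jumpSum s t).mono (ℱ.le t) le_rfl
  obtain ⟨h1, h2⟩ := hN.integral_mul_jump_integral hst htT hξ hZ hZb v
  set K : Ω → ℝ := fun ω => ∫ p in Ioc (s : ℝ) t ×ˢ (univ : Set ℝ),
      (v (ξ ω + p.2) - v (ξ ω)) ∂(N ω) with hK
  have i1 : Integrable (fun ω => Z ω * v (ξ ω + jumpSum N s t ω)) P :=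
    integrable_mul_comp hZ' (hξ'.add hJ) hZb v
  have i2 : Integrable (fun ω => Z ω * v (ξ ω)) P := integrable_mul_comp hZ' hξ' hZb v
  have i3 : Integrable (fun ω => Z ω * ((t - s : ℝ) * jumpGenerator ν v (ξ ω))) P := by
    have := (integrable_mul_comp (P := P) hZ' hξ' hZb (jumpGenerator ν v)).const_mul (t - s : ℝ)
    refine this.congr (Eventually.of_forall fun ω => ?_)
    simp only; ring
  have hsplit : ∫ ω, Z ω * v (ξ ω + jumpSum N s t ω) ∂P
      - ∫ ω, Z ω * (v + (t - s : ℝ) • jumpGenerator ν v) (ξ ω) ∂P =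
      ∫ ω, Z ω * (v (ξ ω + jumpSum N s t ω) - v (ξ ω) - K ω) ∂P := by
    have e1 : ∫ ω, Z ω * (v + (t - s : ℝ) • jumpGenerator ν v) (ξ ω) ∂P =
        ∫ ω, Z ω * v (ξ ω) ∂P + ∫ ω, Z ω * ((t - s : ℝ) * jumpGenerator ν v (ξ ω)) ∂P := by
      rw [← integral_add i2 i3]
      refine integral_congr_ae (Eventually.of_forall fun ω => ?_)
      simp only [BoundedContinuousFunction.coe_add, BoundedContinuousFunction.coe_smul,
        Pi.add_apply, smul_eq_mul]
      ring
    have i12 : Integrable (fun ω => Z ω * v (ξ ω) + Z ω * K ω) P := i2.add h1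
    rw [e1, ← h2, ← integral_add i2 h1, ← integral_sub i1 i12]
    refine integral_congr_ae (Eventually.of_forall fun ω => ?_)
    simp only
    ring
  rw [hsplit]
  have hm : MeasurableSet (Ioc (s : ℝ) t ×ˢ (univ : Set ℝ)) := measurableSet_Ioc.prod .univ
  have hbound : ∫⁻ ω, ‖Z ω * (v (ξ ω + jumpSum N s t ω) - v (ξ ω) - K ω)‖ₑ ∂P ≤
      ENNReal.ofReal (6 * ν.real univ ^ 2 * (t - s) ^ 2 * ‖v‖) := by
    -- The constant `6` is `2` from the pointwise remainder times `3` from the Poisson estimate on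
    -- two or more jumps.
    calc _ ≤ ∫⁻ ω, ENNReal.ofReal (2 * ‖v‖) * (if 2 ≤ N ω (Ioc (s : ℝ) t ×ˢ univ) then
            1 + N ω (Ioc (s : ℝ) t ×ˢ univ) else 0) ∂P := by
          refine lintegral_mono_ae ?_
          filter_upwards [hN.ae_enorm_remainder_le s t ξ v] with ω hω
          rw [enorm_mul]
          refine le_trans ?_ hω
          calc _ ≤ 1 * ‖v (ξ ω + jumpSum N s t ω) - v (ξ ω) - K ω‖ₑ := by
                gcongr
                rw [← ofReal_norm]
                exact ENNReal.ofReal_le_one.2 (hZb _)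
            _ = _ := one_mul _
      _ ≤ ENNReal.ofReal (2 * ‖v‖) * (3 * (timeJump T ν (Ioc (s : ℝ) t ×ˢ univ)) ^ 2) := by
          rw [lintegral_const_mul' _ _ ENNReal.ofReal_ne_top]
          gcongr
          exact hN.toIsPoissonRandomMeasure.lintegral_two_le hm (measure_ne_top _ _)
      _ = _ := by
          rw [timeJump_Ioc_prod s.coe_nonneg htT, ← ofReal_measureReal (μ := ν) (s := univ),
            ← ENNReal.ofReal_mul (sub_nonneg.2 hst'), ← ENNReal.ofReal_pow
            (mul_nonneg (sub_nonneg.2 hst') measureReal_nonneg),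
            show (3 : ℝ≥0∞) = ENNReal.ofReal 3 by simp, ← ENNReal.ofReal_mul (by norm_num),
            ← ENNReal.ofReal_mul (by positivity)]
          congr 1
          ring
  rw [← Real.norm_eq_abs]
  refine (norm_integral_le_lintegral_norm _).trans ?_
  simp only [ofReal_norm]
  exact ENNReal.toReal_le_of_le_ofReal (by positivity) hbound

end IsPoissonRandomMeasureFor

end JumpSum

/-! ### Semilinear backward evolution equations with a bounded operator -/

section Evolution

variable {E : Type*} [NormedAddCommGroup E] [NormedSpace ℝ E] [CompleteSpace E]

omit [CompleteSpace E] in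
lemma norm_exp_clm_le (A : E →L[ℝ] E) : ‖NormedSpace.exp A‖ ≤ Real.exp ‖A‖ := by
  rw [NormedSpace.exp_eq_tsum ℝ]
  have hs : HasSum (fun n : ℕ => ‖A‖ ^ n / n.factorial) (Real.exp ‖A‖) := by
    rw [Real.exp_eq_exp_ℝ]
    exact NormedSpace.expSeries_div_hasSum_exp ‖A‖
  refine tsum_of_norm_bounded hs fun n => ?_
  have hpow : ‖A ^ n‖ ≤ ‖A‖ ^ n := by
    -- The space may be trivial, so `‖1‖ = 1` is not available and the zeroth power is bounded
    -- separately.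
    rcases n.eq_zero_or_pos with rfl | hn
    · rw [pow_zero, pow_zero]
      exact ContinuousLinearMap.norm_id_le
    · exact norm_pow_le' A hn
  rw [norm_smul, norm_inv, Real.norm_natCast, div_eq_inv_mul]
  gcongr

/-- An a priori bound on the solution of the backward equation. -/
noncomputable def evolBound (T ℓ M : ℝ) : ℝ :=
  Real.exp (T * ℓ) * (M + Real.exp (T * ℓ) * M * T)

/-- A Lipschitz constant in time for the solution of the backward equation. -/
noncomputable def evolLip (T ℓ M : ℝ) : ℝ := ℓ * evolBound T ℓ M + M

/-- A Lipschitz constant in time for the derivative of the solution of the backward equation. -/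
noncomputable def evolLip' (T ℓ M : ℝ) : ℝ := ℓ * evolLip T ℓ M + M * (1 + evolLip T ℓ M)

/-- Variation of constants: with `S r = exp (r L)` and `u t = S (T - t) (v t)`, the equation for `v`
has a bounded right-hand side because `F` is bounded. A single Picard–Lindelöf ball then covers all
of `[0, T]`, and no continuation argument is needed. -/
lemma exists_backward_hasDerivWithinAt {L : E →L[ℝ] E} {F : ℝ → E → E} {T M ℓ : ℝ} (hT : 0 ≤ T)
    (hL : ‖L‖ ≤ ℓ) (hM : 0 ≤ M) (hF : ∀ t v, ‖F t v‖ ≤ M)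
    (hFl : ∀ t t' v v', ‖F t' v' - F t v‖ ≤ M * (|t' - t| + ‖v' - v‖)) {φ : E} (hφ : ‖φ‖ ≤ M) :
    ∃ u : ℝ → E, u T = φ ∧ (∀ t ∈ Icc 0 T, ‖u t‖ ≤ evolBound T ℓ M) ∧
      ∀ t ∈ Icc 0 T, HasDerivWithinAt u (-(L (u t) + F t (u t))) (Icc 0 T) t := by
  set S : ℝ → E →L[ℝ] E := fun r => NormedSpace.exp (r • L) with hS
  set B : ℝ := Real.exp (T * ℓ) with hB
  have hB0 : 0 ≤ B := (Real.exp_pos _).le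
  have hSB : ∀ r, |r| ≤ T → ‖S r‖ ≤ B := by
    intro r hr
    refine (norm_exp_clm_le _).trans (Real.exp_le_exp.2 ?_)
    rw [norm_smul]
    exact mul_le_mul hr hL (norm_nonneg _) hT
  have hSd : ∀ r, HasDerivAt S (L * S r) r := fun r => hasDerivAt_exp_smul_const' L r
  have hSc : Continuous S := continuous_iff_continuousAt.2 fun r => (hSd r).continuousAt
  have hSinv : ∀ r v, S r (S (-r) v) = v := by
    intro r v
    have h : S r * S (-r) = 1 := by
      rw [hS]
      simp only
      have := NormedAlgebra.restrictScalars ℚ ℝ (E →L[ℝ] E)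
      rw [← NormedSpace.exp_add_of_commute, ← add_smul]
      · simp
      · exact ((Commute.refl L).smul_left r).smul_right (-r)
    exact congrArg (fun A : E →L[ℝ] E => A v) h
  have hFc : Continuous (fun p : ℝ × E => F p.1 p.2) := by
    rw [continuous_iff_continuousAt]
    intro p
    rw [ContinuousAt, tendsto_iff_norm_sub_tendsto_zero]
    refine squeeze_zero (fun _ => norm_nonneg _) (fun q => hFl p.1 q.1 p.2 q.2) ?_
    have : Continuous fun q : ℝ × E => M * (|q.1 - p.1| + ‖q.2 - p.2‖) := by fun_prop
    have h := this.tendsto p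
    simpa using h
  set W : ℝ → E → E := fun t v => -(S (-(T - t)) (F t (S (T - t) v))) with hW
  have habs : ∀ t ∈ Icc 0 T, |T - t| ≤ T := fun t ht => by
    rw [abs_le]; constructor <;> linarith [ht.1, ht.2]
  have hWB : ∀ t ∈ Icc 0 T, ∀ v, ‖W t v‖ ≤ B * M := by
    intro t ht v
    rw [hW, norm_neg]
    refine (ContinuousLinearMap.le_opNorm _ _).trans ?_
    exact mul_le_mul (hSB _ (by rw [abs_neg]; exact habs t ht)) (hF _ _) (norm_nonneg _) hB0
  -- The radius is the speed bound `B M` times the length `T`, so the solution cannot leave the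
  -- ball; the Lipschitz constant `B M B` comes from the two exponentials around `F`.
  have hpl : IsPicardLindelof W (tmin := 0) (tmax := T) ⟨T, right_mem_Icc.2 hT⟩ φ
      (B * M * T).toNNReal 0 (B * M).toNNReal (B * M * B).toNNReal := by
    refine ⟨fun t ht => ?_, fun v _ => ?_, fun t ht v _ => ?_, ?_⟩
    · refine (LipschitzWith.of_dist_le_mul fun v w => ?_).lipschitzOnWith
      rw [dist_eq_norm, dist_eq_norm, Real.coe_toNNReal _ (by positivity)]
      have h1 : W t v - W t w = -(S (-(T - t)) (F t (S (T - t) v) - F t (S (T - t) w))) := by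
        rw [hW]; simp only [map_sub]; abel
      rw [h1, norm_neg]
      refine (ContinuousLinearMap.le_opNorm _ _).trans ?_
      have h2 : ‖F t (S (T - t) v) - F t (S (T - t) w)‖ ≤ M * (B * ‖v - w‖) := by
        refine (hFl _ _ _ _).trans ?_
        rw [sub_self, abs_zero, zero_add, ← map_sub]
        gcongr
        exact (ContinuousLinearMap.le_opNorm _ _).trans (by gcongr; exact hSB _ (habs t ht))
      calc _ ≤ B * (M * (B * ‖v - w‖)) := mul_le_mul
            (hSB _ (by rw [abs_neg]; exact habs t ht)) h2 (norm_nonneg _) hB0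
        _ = _ := by ring
    · refine Continuous.continuousOn ?_
      have h1 : Continuous fun t => S (T - t) v :=
        (hSc.comp (continuous_const.sub continuous_id)).clm_apply continuous_const
      have h2 : Continuous fun t => F t (S (T - t) v) := hFc.comp (continuous_id.prodMk h1)
      exact ((hSc.comp (continuous_const.sub continuous_id).neg).clm_apply h2).neg
    · rw [Real.coe_toNNReal _ (by positivity)]
      exact hWB t ht v
    · rw [Real.coe_toNNReal _ (by positivity), Real.coe_toNNReal _ (by positivity)]
      simp [hT]
  obtain ⟨v, hvT, hv⟩ := hpl.exists_eq_forall_mem_Icc_hasDerivWithinAt₀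
  have hvT : v T = φ := hvT
  have hvB : ∀ t ∈ Icc 0 T, ‖v t‖ ≤ M + B * M * T := by
    intro t ht
    have h := (convex_Icc 0 T).norm_image_sub_le_of_norm_hasDerivWithin_le hv
      (fun s hs => hWB s hs (v s)) (right_mem_Icc.2 hT) ht
    rw [hvT, Real.norm_eq_abs, abs_sub_comm] at h
    have h2 : B * M * |T - t| ≤ B * M * T := by gcongr; exact habs t ht
    have h3 := norm_le_norm_add_norm_sub' (v t) φ
    linarith
  refine ⟨fun t => S (T - t) (v t), ?_, fun t ht => ?_, fun t ht => ?_⟩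
  · simp [hS, hvT]
  · refine (ContinuousLinearMap.le_opNorm _ _).trans ?_
    exact mul_le_mul (hSB _ (habs t ht)) (hvB t ht) (norm_nonneg _) hB0
  · have h1 : HasDerivWithinAt (fun t => S (T - t)) (-(L * S (T - t))) (Icc 0 T) t := by
      have := ((hSd (T - t)).scomp t
        ((hasDerivAt_id t).const_sub T)).hasDerivWithinAt (s := Icc 0 T)
      simpa [Function.comp_def] using this
    have h2 := h1.clm_apply (hv t ht)
    convert h2 using 1
    rw [hW]
    simp only [map_neg, hSinv, neg_apply, neg_add]
    rfl

/-- A bounded operator `L` and a bounded Lipschitz nonlinearity `F` admit a global solution of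
`u' = - L u - F(t, u)`, `u(T) = φ`, that is Lipschitz in time with a Lipschitz derivative. -/
lemma exists_backward_evolution {L : E →L[ℝ] E} {F : ℝ → E → E} {T M ℓ : ℝ} (hT : 0 ≤ T)
    (hL : ‖L‖ ≤ ℓ) (hM : 0 ≤ M) (hF : ∀ t v, ‖F t v‖ ≤ M)
    (hFl : ∀ t t' v v', ‖F t' v' - F t v‖ ≤ M * (|t' - t| + ‖v' - v‖)) {φ : E} (hφ : ‖φ‖ ≤ M) :
    ∃ u : ℝ → E, u T = φ ∧ (∀ t ∈ Icc 0 T, ‖u t‖ ≤ evolBound T ℓ M) ∧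
      (∀ t ∈ Icc 0 T, ∀ t' ∈ Icc 0 T, ‖u t' - u t‖ ≤ evolLip T ℓ M * |t' - t|) ∧
      (∀ t ∈ Icc 0 T, ∀ t' ∈ Icc 0 T, ‖u t' - u t + (t' - t) • (L (u t) + F t (u t))‖ ≤
        evolLip' T ℓ M * (t' - t) ^ 2) := by
  obtain ⟨u, huT, hub, hud⟩ := exists_backward_hasDerivWithinAt hT hL hM hF hFl hφ
  have hℓ : 0 ≤ ℓ := (norm_nonneg _).trans hL
  have hB1 : 0 ≤ evolLip T ℓ M := by unfold evolLip evolBound; positivity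
  have hLu : ∀ v, ‖L v‖ ≤ ℓ * ‖v‖ := fun v => (L.le_opNorm v).trans (by gcongr)
  have hlip : ∀ t ∈ Icc 0 T, ∀ t' ∈ Icc 0 T, ‖u t' - u t‖ ≤ evolLip T ℓ M * |t' - t| := by
    intro t ht t' ht'
    refine (convex_Icc 0 T).norm_image_sub_le_of_norm_hasDerivWithin_le hud (fun s hs => ?_) ht ht'
    rw [norm_neg]
    refine (norm_add_le _ _).trans (add_le_add ((hLu _).trans ?_) (hF _ _))
    gcongr
    exact hub s hs
  refine ⟨u, huT, hub, hlip, fun t ht t' ht' => ?_⟩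
  set c : E := L (u t) + F t (u t) with hc
  have hsub : uIcc t t' ⊆ Icc 0 T := uIcc_subset_Icc ht ht'
  -- Adding `s • c` cancels the derivative at `t`. What is left is an increment of `L u + F (·, u)`,
  -- which is Lipschitz in time, so the mean value inequality gives a quadratic bound.
  have hd : ∀ s ∈ uIcc t t', HasDerivWithinAt (fun s => u s + s • c)
      (-(L (u s) + F s (u s)) + c) (uIcc t t') s := by
    intro s hs
    have h1 := (hud s (hsub hs)).mono hsub
    have h2 : HasDerivWithinAt (fun s : ℝ => s • c) c (uIcc t t') s := by
      simpa using ((hasDerivAt_id s).smul_const c).hasDerivWithinAt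
    exact h1.add h2
  have hbd : ∀ s ∈ uIcc t t', ‖-(L (u s) + F s (u s)) + c‖ ≤ evolLip' T ℓ M * |t' - t| := by
    intro s hs
    have hst : |s - t| ≤ |t' - t| := abs_sub_left_of_mem_uIcc hs
    have h1 := hlip t ht s (hsub hs)
    have h2 := hFl t s (u t) (u s)
    have h3 := hLu (u s - u t)
    have h4 : -(L (u s) + F s (u s)) + c = -(L (u s - u t) + (F s (u s) - F t (u t))) := by
      rw [hc, map_sub]; abel
    rw [h4, norm_neg]
    calc _ ≤ ℓ * (evolLip T ℓ M * |t' - t|) + M * (|t' - t| + evolLip T ℓ M * |t' - t|) := by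
          refine (norm_add_le _ _).trans (add_le_add (h3.trans ?_) (h2.trans ?_))
          · gcongr; exact h1.trans (by gcongr)
          · gcongr; exact h1.trans (by gcongr)
      _ = _ := by unfold evolLip'; ring
  have h := (convex_uIcc t t').norm_image_sub_le_of_norm_hasDerivWithin_le hd hbd left_mem_uIcc
    right_mem_uIcc
  calc _ = ‖u t' + t' • c - (u t + t • c)‖ := by congr 1; rw [sub_smul]; abel
    _ ≤ _ := h
    _ = _ := by rw [Real.norm_eq_abs, mul_assoc, ← sq, sq_abs]

end Evolution

/-! ### Families of functionals with a bounded generator -/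

lemma continuousOn_of_lipschitz {E : Type*} [NormedAddCommGroup E] {v : ℝ → E} {B : ℝ} {s : Set ℝ}
    (h : ∀ t ∈ s, ∀ t' ∈ s, ‖v t' - v t‖ ≤ B * |t' - t|) : ContinuousOn v s := by
  intro t ht
  rw [ContinuousWithinAt, tendsto_iff_norm_sub_tendsto_zero]
  have hlim : Tendsto (fun r' : ℝ => B * |r' - t|) (𝓝[s] t) (𝓝 0) := by
    have : Continuous (fun r' : ℝ => B * |r' - t|) := by fun_prop
    simpa using (this.tendsto t).mono_left nhdsWithin_le_nhds
  refine squeeze_zero' (Eventually.of_forall fun _ => norm_nonneg _) ?_ hlim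
  filter_upwards [self_mem_nhdsWithin] with r' hr'
  exact h t ht r' hr'

/-- A family of contractive functionals `Φ r`, `r ∈ [s, T]`, whose increments are governed by a
bounded operator `L` up to an error of second order. -/
structure IsFlow {E : Type*} [NormedAddCommGroup E] [NormedSpace ℝ E] (L : E →L[ℝ] E)
    (c s T : ℝ) (Φ : ℝ → E →L[ℝ] ℝ) : Prop where
  abs_le : ∀ r v, |Φ r v| ≤ ‖v‖
  increment : ∀ r r', s ≤ r → r ≤ r' → r' ≤ T → ∀ v,
    |Φ r' v - Φ r (v + (r' - r) • L v)| ≤ c * (r' - r) ^ 2 * ‖v‖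

namespace IsFlow

variable {E : Type*} [NormedAddCommGroup E] [NormedSpace ℝ E] {L : E →L[ℝ] E} {c s T : ℝ}
  {Φ : ℝ → E →L[ℝ] ℝ}

lemma abs_sub_le_of_le (h : IsFlow L c s T Φ) (hc : 0 ≤ c) {r r' : ℝ} (hr : s ≤ r) (hrr : r ≤ r')
    (hr' : r' ≤ T) (v : E) : |Φ r' v - Φ r v| ≤ (‖L‖ + c * (T - s)) * ‖v‖ * (r' - r) := by
  have h1 := h.increment r r' hr hrr hr' v
  have h2 := h.abs_le r (L v)
  have h3 := L.le_opNorm v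
  rw [map_add, map_smul, smul_eq_mul] at h1
  have h4 : |(r' - r) * Φ r (L v)| ≤ (r' - r) * (‖L‖ * ‖v‖) := by
    rw [abs_mul, abs_of_nonneg (sub_nonneg.2 hrr)]
    exact mul_le_mul_of_nonneg_left (h2.trans h3) (sub_nonneg.2 hrr)
  have h5 : c * (r' - r) ^ 2 * ‖v‖ ≤ c * ((T - s) * (r' - r)) * ‖v‖ := by
    rw [sq]
    gcongr
  calc |Φ r' v - Φ r v|
      = |(Φ r' v - (Φ r v + (r' - r) * Φ r (L v))) + (r' - r) * Φ r (L v)| := by ring_nf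
    _ ≤ _ := (abs_add_le _ _).trans (add_le_add (h1.trans h5) h4)
    _ = _ := by ring

lemma abs_sub_le (h : IsFlow L c s T Φ) (hc : 0 ≤ c) {r r' : ℝ} (hr : r ∈ Icc s T)
    (hr' : r' ∈ Icc s T) (v : E) : |Φ r' v - Φ r v| ≤ (‖L‖ + c * (T - s)) * ‖v‖ * |r' - r| := by
  rcases le_total r r' with h1 | h1
  · rw [abs_of_nonneg (sub_nonneg.2 h1)]
    exact h.abs_sub_le_of_le hc hr.1 h1 hr'.2 v
  · rw [abs_sub_comm, abs_sub_comm r' r, abs_of_nonneg (sub_nonneg.2 h1)]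
    exact h.abs_sub_le_of_le hc hr'.1 h1 hr.2 v

lemma continuousOn (h : IsFlow L c s T Φ) (hc : 0 ≤ c) {v : ℝ → E}
    (hv : ContinuousOn v (Icc s T)) : ContinuousOn (fun r => Φ r (v r)) (Icc s T) := by
  intro r hr
  rw [ContinuousWithinAt, tendsto_iff_norm_sub_tendsto_zero]
  have hlim : Tendsto (fun r' => ‖v r' - v r‖ + (‖L‖ + c * (T - s)) * ‖v r‖ * |r' - r|)
      (𝓝[Icc s T] r) (𝓝 0) := by
    have h1 := tendsto_iff_norm_sub_tendsto_zero.1 (hv r hr)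
    have h2 : Tendsto (fun r' : ℝ => (‖L‖ + c * (T - s)) * ‖v r‖ * |r' - r|) (𝓝[Icc s T] r)
        (𝓝 0) := by
      have : Continuous (fun r' : ℝ => (‖L‖ + c * (T - s)) * ‖v r‖ * |r' - r|) := by fun_prop
      simpa using (this.tendsto r).mono_left nhdsWithin_le_nhds
    simpa using h1.add h2
  refine squeeze_zero' (Eventually.of_forall fun _ => norm_nonneg _) ?_ hlim
  filter_upwards [self_mem_nhdsWithin] with r' hr'
  have h1 := h.abs_le r' (v r' - v r)
  have h2 := h.abs_sub_le hc hr hr' (v r)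
  rw [map_sub] at h1
  rw [Real.norm_eq_abs]
  calc |Φ r' (v r') - Φ r (v r)|
      = |(Φ r' (v r') - Φ r' (v r)) + (Φ r' (v r) - Φ r (v r))| := by ring_nf
    _ ≤ _ := (abs_add_le _ _).trans (add_le_add h1 h2)

/-- A product rule: `Φ` contributes `L` and the argument contributes `u'`. Only the right derivative
is obtained, since `increment` expands forward from the earlier time; for continuous functions this
is enough for the fundamental theorem of calculus. -/
lemma hasDerivWithinAt (h : IsFlow L c s T Φ) (hc : 0 ≤ c) {u u' : ℝ → E} {B₀ B₁ B₂ : ℝ}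
    (hu₀ : ∀ r ∈ Icc s T, ‖u r‖ ≤ B₀)
    (hu₁ : ∀ r ∈ Icc s T, ∀ r' ∈ Icc s T, ‖u r' - u r‖ ≤ B₁ * |r' - r|)
    (hu₂ : ∀ r ∈ Icc s T, ∀ r' ∈ Icc s T, ‖u r' - u r - (r' - r) • u' r‖ ≤ B₂ * (r' - r) ^ 2)
    {r : ℝ} (hr : r ∈ Ico s T) :
    HasDerivWithinAt (fun r => Φ r (u r)) (Φ r (L (u r) + u' r)) (Ioi r) r := by
  have hr1 : r ∈ Icc s T := ⟨hr.1, hr.2.le⟩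
  rw [hasDerivWithinAt_iff_isLittleO]
  have hO : (fun r' => Φ r' (u r') - Φ r (u r) - (r' - r) • Φ r (L (u r) + u' r))
      =O[𝓝[>] r] fun r' => (r' - r) ^ 2 := by
    refine Asymptotics.IsBigO.of_bound (c * B₀ + B₂ + ‖L‖ * B₁) ?_
    filter_upwards [Ioo_mem_nhdsGT hr.2] with r' hr'
    have hr'1 : r' ∈ Icc s T := ⟨hr.1.trans hr'.1.le, hr'.2.le⟩
    have hpos : 0 ≤ r' - r := sub_nonneg.2 hr'.1.le
    have h1 := h.increment r r' hr.1 hr'.1.le hr'.2.le (u r')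
    have h2 := (h.abs_le r _).trans (hu₂ r hr1 r' hr'1)
    have h3 : |(r' - r) * Φ r (L (u r' - u r))| ≤ (r' - r) * (‖L‖ * (B₁ * (r' - r))) := by
      rw [abs_mul, abs_of_nonneg hpos]
      refine mul_le_mul_of_nonneg_left ((h.abs_le r _).trans ((L.le_opNorm _).trans ?_)) hpos
      have := hu₁ r hr1 r' hr'1
      rw [abs_of_nonneg hpos] at this
      gcongr
    have h4 : c * (r' - r) ^ 2 * ‖u r'‖ ≤ c * (r' - r) ^ 2 * B₀ := by
      gcongr
      exact hu₀ r' hr'1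
    simp only [map_add, map_smul, map_sub, smul_eq_mul] at h1 h2 h3 ⊢
    rw [Real.norm_eq_abs, Real.norm_eq_abs, abs_of_nonneg (sq_nonneg (r' - r))]
    calc _ = |(Φ r' (u r') - (Φ r (u r') + (r' - r) * Φ r (L (u r')))) +
            (Φ r (u r') - Φ r (u r) - (r' - r) * Φ r (u' r)) +
            (r' - r) * (Φ r (L (u r')) - Φ r (L (u r)))| := by ring_nf
      _ ≤ c * (r' - r) ^ 2 * B₀ + B₂ * (r' - r) ^ 2 + (r' - r) * (‖L‖ * (B₁ * (r' - r))) :=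
          (abs_add_three _ _ _).trans (add_le_add (add_le_add (h1.trans h4) h2) h3)
      _ = _ := by ring
  refine hO.trans_isLittleO ?_
  have : (fun r' : ℝ => (r' - r) ^ 2) =o[𝓝 r] fun r' => (r' - r) := by
    have h0 : Tendsto (fun r' : ℝ => r' - r) (𝓝 r) (𝓝 0) := by
      have : Continuous fun r' : ℝ => r' - r := by fun_prop
      simpa using this.tendsto r
    simpa [Function.comp_def] using
      (Asymptotics.isLittleO_pow_id (𝕜 := ℝ) one_lt_two).comp_tendsto h0
  exact this.mono nhdsWithin_le_nhds

/-- Integrated form of the evolution equation along a flow. -/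
lemma eq_add_integral (h : IsFlow L c s T Φ) (hc : 0 ≤ c) {u w : ℝ → E} {B₀ B₁ B₂ : ℝ}
    (hu₀ : ∀ r ∈ Icc s T, ‖u r‖ ≤ B₀)
    (hu₁ : ∀ r ∈ Icc s T, ∀ r' ∈ Icc s T, ‖u r' - u r‖ ≤ B₁ * |r' - r|)
    (hu₂ : ∀ r ∈ Icc s T, ∀ r' ∈ Icc s T,
      ‖u r' - u r + (r' - r) • (L (u r) + w r)‖ ≤ B₂ * (r' - r) ^ 2)
    (hw : ContinuousOn w (Icc s T)) {t : ℝ} (hst : s ≤ t) (htT : t ≤ T) :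
    Φ s (u s) = Φ t (u t) + ∫ r in s..t, Φ r (w r) := by
  have huc : ContinuousOn u (Icc s T) := continuousOn_of_lipschitz hu₁
  have hsub : Icc s t ⊆ Icc s T := Icc_subset_Icc_right htT
  have hwc := (h.continuousOn hc hw).mono hsub
  have hint : IntervalIntegrable (fun r => -Φ r (w r)) volume s t :=
    (hwc.neg).intervalIntegrable_of_Icc hst
  have hftc := intervalIntegral.integral_eq_sub_of_hasDeriv_right_of_le hst
    ((h.continuousOn hc huc).mono hsub)
    -- With `u' = -(L u + w)` the two `L` terms cancel and the derivative is `-Φ r (w r)`.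
    (fun r hr => by
      have := h.hasDerivWithinAt hc (u' := fun r => -(L (u r) + w r)) hu₀ hu₁
        (fun r hr r' hr' => by rw [smul_neg, sub_neg_eq_add]; exact hu₂ r hr r' hr')
        (r := r) ⟨hr.1.le, hr.2.trans_le htT⟩
      have e : -(L (u r) + w r) + L (u r) = -w r := by abel
      rw [add_comm, e, map_neg] at this
      exact this) hint
  rw [intervalIntegral.integral_neg] at hftc
  linarith

/-- A first order expansion of `r ↦ Φ r (w r)` at the initial time, with quadratic remainder. -/
lemma abs_sub_sub_le (h : IsFlow L c s T Φ) (hc : 0 ≤ c) {w : ℝ → E} {M W₁ W₂ β : ℝ} {r : ℝ}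
    (hsr : s ≤ r) (hrT : r ≤ T) (hw₀ : ‖w r‖ ≤ M) (hw₁ : ‖w r - w s‖ ≤ W₁ * (r - s))
    (hw₂ : |Φ s (w r - w s) - (r - s) * β| ≤ W₂ * (r - s) ^ 2) :
    |Φ r (w r) - Φ s (w s) - (Φ s (L (w s)) + β) * (r - s)| ≤
      (c * M + ‖L‖ * W₁ + W₂) * (r - s) ^ 2 := by
  have hpos : 0 ≤ r - s := sub_nonneg.2 hsr
  have h1 := h.increment s r le_rfl hsr hrT (w r)
  have h2 : c * (r - s) ^ 2 * ‖w r‖ ≤ c * (r - s) ^ 2 * M := by gcongr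
  have h3 : |(r - s) * Φ s (L (w r - w s))| ≤ (r - s) * (‖L‖ * (W₁ * (r - s))) := by
    rw [abs_mul, abs_of_nonneg hpos]
    exact mul_le_mul_of_nonneg_left ((h.abs_le s _).trans ((L.le_opNorm _).trans (by gcongr))) hpos
  simp only [map_add, map_smul, map_sub, smul_eq_mul] at h1 h3 hw₂
  calc _ = |(Φ r (w r) - (Φ s (w r) + (r - s) * Φ s (L (w r)))) +
          (r - s) * (Φ s (L (w r)) - Φ s (L (w s))) +
          (Φ s (w r) - Φ s (w s) - (r - s) * β)| := by ring_nf
    _ ≤ c * (r - s) ^ 2 * M + (r - s) * (‖L‖ * (W₁ * (r - s))) + W₂ * (r - s) ^ 2 :=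
        (abs_add_three _ _ _).trans (add_le_add (add_le_add (h1.trans h2) h3) hw₂)
    _ = _ := by ring

end IsFlow

/-- The trapezoidal rule is of third order for functions with a first order Taylor expansion at the
left end point. -/
lemma abs_integral_sub_trapezoid_le {G : ℝ → ℝ} {a b C β : ℝ} (hab : a ≤ b)
    (hG : ContinuousOn G (Icc a b))
    (h : ∀ r ∈ Icc a b, |G r - G a - β * (r - a)| ≤ C * (r - a) ^ 2) :
    |(∫ r in a..b, G r) - (b - a) / 2 * (G a + G b)| ≤ C * (b - a) ^ 3 := by
  have hC : 0 ≤ C * (b - a) ^ 2 := (abs_nonneg _).trans (h b (right_mem_Icc.2 hab))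
  have hGi : IntervalIntegrable G volume a b := hG.intervalIntegrable_of_Icc hab
  -- The rule is exact on the affine part. The remainder costs `C (b - a)³ / 3` in the integral and
  -- `C (b - a)³ / 2` through the value at `b`; together this is below `C (b - a)³`.
  have e1 : ∫ r in a..b, (G a + β * (r - a)) = (b - a) * G a + β * ((b - a) ^ 2 / 2) := by
    rw [intervalIntegral.integral_add (by simp) (Continuous.intervalIntegrable (by fun_prop) _ _),
      intervalIntegral.integral_const, intervalIntegral.integral_const_mul,
      intervalIntegral.integral_comp_sub_right (fun x => x), integral_id]
    simp
  have e2 : |∫ r in a..b, (G r - (G a + β * (r - a)))| ≤ C * ((b - a) ^ 3 / 3) := by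
    have hle : ∀ r ∈ Icc a b, |G r - (G a + β * (r - a))| ≤ C * (r - a) ^ 2 := fun r hr => by
      rw [← sub_sub]; exact h r hr
    refine (intervalIntegral.abs_integral_le_integral_abs hab).trans ?_
    have := intervalIntegral.integral_mono_on hab
      (hGi.sub (Continuous.intervalIntegrable (by fun_prop) _ _)).abs
      (Continuous.intervalIntegrable (u := fun r => C * (r - a) ^ 2) (by fun_prop) _ _) hle
    refine this.trans (le_of_eq ?_)
    rw [intervalIntegral.integral_const_mul,
      intervalIntegral.integral_comp_sub_right (fun x => x ^ 2), integral_pow]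
    norm_num
  rw [intervalIntegral.integral_sub hGi (Continuous.intervalIntegrable (by fun_prop) _ _), e1] at e2
  have e3 := h b (right_mem_Icc.2 hab)
  have e4 : |(b - a) / 2 * (G b - G a - β * (b - a))| ≤ (b - a) / 2 * (C * (b - a) ^ 2) := by
    rw [abs_mul, abs_of_nonneg (by linarith : 0 ≤ (b - a) / 2)]
    exact mul_le_mul_of_nonneg_left e3 (by linarith)
  have hC3 : 0 ≤ C * (b - a) ^ 2 * (b - a) := mul_nonneg hC (sub_nonneg.2 hab)
  calc _ = |((∫ r in a..b, G r) - ((b - a) * G a + β * ((b - a) ^ 2 / 2))) -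
          (b - a) / 2 * (G b - G a - β * (b - a))| := by ring_nf
    _ ≤ C * ((b - a) ^ 3 / 3) + (b - a) / 2 * (C * (b - a) ^ 2) :=
        (abs_sub _ _).trans (add_le_add e2 e4)
    _ ≤ _ := by nlinarith

/-! ### Generators of the backward equation as operators on bounded continuous functions -/

/-- The quantitative regularity of the generator that enters the error analysis: bounds, a
Lipschitz estimate, and first order expansions in `(t, y)` with quadratic remainder. -/
structure IsRegularGenerator (T M : ℝ) (f : ℝ → ℝ → ℝ → ℝ) : Prop where
  abs_le : ∀ t ∈ Icc 0 T, ∀ x y, |f t x y| ≤ M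
  lipschitz : ∀ t ∈ Icc 0 T, ∀ t' ∈ Icc 0 T, ∀ x x' y y',
    |f t' x' y' - f t x y| ≤ M * (|t' - t| + |x' - x| + |y' - y|)
  taylor : ∀ t ∈ Icc 0 T, ∀ x y, ∃ p q : ℝ, |q| ≤ M ∧ ∀ t' ∈ Icc 0 T, ∀ y',
    |f t' x y' - f t x y - (p * (t' - t) + q * (y' - y))| ≤ M * (|t' - t| + |y' - y|) ^ 2

namespace IsRegularGenerator

variable {T M : ℝ} {f : ℝ → ℝ → ℝ → ℝ}

lemma nonneg (hf : IsRegularGenerator T M f) (hT : 0 ≤ T) : 0 ≤ M :=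
  (abs_nonneg _).trans (hf.abs_le 0 (left_mem_Icc.2 hT) 0 0)

/-- The function `(t, x, y) ↦ f (t, x, y)`, with `t` clamped to `[0, T]`, is continuous. -/
lemma continuous_clamp (hf : IsRegularGenerator T M f) (hT : 0 ≤ T) :
    Continuous (fun q : ℝ × ℝ × ℝ => f (projIcc 0 T hT q.1) q.2.1 q.2.2) := by
  rw [continuous_iff_continuousAt]
  intro q
  rw [ContinuousAt, tendsto_iff_norm_sub_tendsto_zero]
  refine squeeze_zero (fun _ => norm_nonneg _) (fun q' => hf.lipschitz _ (projIcc 0 T hT q.1).2 _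
    (projIcc 0 T hT q'.1).2 q.2.1 q'.2.1 q.2.2 q'.2.2) ?_
  have : Continuous fun q' : ℝ × ℝ × ℝ => M * (|(projIcc 0 T hT q'.1 : ℝ) - projIcc 0 T hT q.1| +
      |q'.2.1 - q.2.1| + |q'.2.2 - q.2.2|) := by
    have h := (continuous_projIcc (h := hT)).comp (continuous_fst (X := ℝ) (Y := ℝ × ℝ))
    have h' : Continuous fun q' : ℝ × ℝ × ℝ => (projIcc 0 T hT q'.1 : ℝ) :=
      continuous_subtype_val.comp h
    fun_prop
  simpa using this.tendsto q

/-- The superposition operator `v ↦ f (t, ·, v ·)`. -/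
noncomputable def superposition (hf : IsRegularGenerator T M f) (hT : 0 ≤ T) (t : ℝ)
    (v : ℝ →ᵇ ℝ) : ℝ →ᵇ ℝ :=
  BoundedContinuousFunction.ofNormedAddCommGroup (fun x => f (projIcc 0 T hT t) x (v x))
    ((hf.continuous_clamp hT).comp (continuous_const.prodMk (continuous_id.prodMk v.continuous)))
    M (fun _ => hf.abs_le _ (projIcc 0 T hT t).2 _ _)

lemma superposition_apply (hf : IsRegularGenerator T M f) (hT : 0 ≤ T) {t : ℝ} (ht : t ∈ Icc 0 T)
    (v : ℝ →ᵇ ℝ) (x : ℝ) : hf.superposition hT t v x = f t x (v x) := by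
  change f (projIcc 0 T hT t) x (v x) = _
  rw [projIcc_of_mem hT ht]

lemma norm_superposition_le (hf : IsRegularGenerator T M f) (hT : 0 ≤ T) (t : ℝ) (v : ℝ →ᵇ ℝ) :
    ‖hf.superposition hT t v‖ ≤ M :=
  BoundedContinuousFunction.norm_ofNormedAddCommGroup_le _ (hf.nonneg hT) _

/-- Clamping time to `[0, T]` does not increase distances, so the estimate extends to all real
times, as `exists_backward_evolution` requires. -/
lemma norm_superposition_sub_le (hf : IsRegularGenerator T M f) (hT : 0 ≤ T) (t t' : ℝ)
    (v v' : ℝ →ᵇ ℝ) : ‖hf.superposition hT t' v' - hf.superposition hT t v‖ ≤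
      M * (|t' - t| + ‖v' - v‖) := by
  have hM := hf.nonneg hT
  rw [BoundedContinuousFunction.norm_le (by positivity)]
  intro x
  refine (hf.lipschitz _ (projIcc 0 T hT t).2 _ (projIcc 0 T hT t').2 x x (v x) (v' x)).trans ?_
  rw [sub_self, abs_zero, add_zero]
  exact mul_le_mul_of_nonneg_left (add_le_add (abs_projIcc_sub_projIcc hT)
    ((v' - v).norm_coe_le_norm x)) hM

end IsRegularGenerator

/-- The functions `u` and `w = f (·, ·, u)` with the estimates that the error analysis needs, where
`u` solves `∂_t u + L u + f (t, x, u) = 0`, `u (T, ·) = φ`. -/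
structure IsBackwardSolution (ν : Measure ℝ) [IsFiniteMeasure ν] (T M : ℝ) (φ : ℝ → ℝ)
    (f : ℝ → ℝ → ℝ → ℝ) (u w : ℝ → ℝ →ᵇ ℝ) : Prop where
  terminal : ∀ x, u T x = φ x
  source : ∀ t ∈ Icc 0 T, ∀ x, w t x = f t x (u t x)
  norm_le : ∀ t ∈ Icc 0 T, ‖u t‖ ≤ evolBound T (2 * ν.real univ) M
  lipschitz : ∀ t ∈ Icc 0 T, ∀ t' ∈ Icc 0 T,
    ‖u t' - u t‖ ≤ evolLip T (2 * ν.real univ) M * |t' - t|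
  taylor : ∀ t ∈ Icc 0 T, ∀ t' ∈ Icc 0 T,
    ‖u t' - u t + (t' - t) • (jumpGenerator ν (u t) + w t)‖ ≤
      evolLip' T (2 * ν.real univ) M * (t' - t) ^ 2
  norm_source_le : ∀ t, ‖w t‖ ≤ M
  norm_source_sub_le : ∀ t ∈ Icc 0 T, ∀ t' ∈ Icc 0 T,
    ‖w t' - w t‖ ≤ M * (1 + evolLip T (2 * ν.real univ) M) * |t' - t|

lemma exists_isBackwardSolution (ν : Measure ℝ) [IsFiniteMeasure ν] {T M : ℝ} (hT : 0 ≤ T)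
    {f : ℝ → ℝ → ℝ → ℝ} (hf : IsRegularGenerator T M f) {φ : ℝ → ℝ} (hφ : Continuous φ)
    (hφM : ∀ x, |φ x| ≤ M) : ∃ u w, IsBackwardSolution ν T M φ f u w := by
  have hM := hf.nonneg hT
  set φ' : ℝ →ᵇ ℝ := BoundedContinuousFunction.ofNormedAddCommGroup φ hφ M hφM with hφ'
  obtain ⟨u, h1, h2, h3, h4⟩ := exists_backward_evolution (φ := φ') hT (norm_jumpGenerator_le ν) hM
    (hf.norm_superposition_le hT) (hf.norm_superposition_sub_le hT)
    (BoundedContinuousFunction.norm_ofNormedAddCommGroup_le _ hM _)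
  refine ⟨u, fun t => hf.superposition hT t (u t), fun x => ?_, fun t ht x => ?_, h2, h3, h4,
    fun t => hf.norm_superposition_le hT t _, fun t ht t' ht' => ?_⟩
  · rw [h1]; rfl
  · exact hf.superposition_apply hT ht _ _
  · calc _ ≤ _ := hf.norm_superposition_sub_le hT t t' (u t) (u t')
      _ ≤ M * (|t' - t| + evolLip T (2 * ν.real univ) M * |t' - t|) := by
          gcongr; exact h3 t ht t' ht'
      _ = _ := by ring

namespace IsBackwardSolution

variable {ν : Measure ℝ} [IsFiniteMeasure ν] {T M : ℝ} {φ : ℝ → ℝ}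
  {f : ℝ → ℝ → ℝ → ℝ} {u w : ℝ → ℝ →ᵇ ℝ}

lemma continuousOn_source (h : IsBackwardSolution ν T M φ f u w) : ContinuousOn w (Icc 0 T) :=
  continuousOn_of_lipschitz h.norm_source_sub_le

lemma continuousOn (h : IsBackwardSolution ν T M φ f u w) : ContinuousOn u (Icc 0 T) :=
  continuousOn_of_lipschitz h.lipschitz

lemma eq_add_integral (h : IsBackwardSolution ν T M φ f u w) {s t c : ℝ} {Φ : ℝ → (ℝ →ᵇ ℝ) →L[ℝ] ℝ}
    (hc : 0 ≤ c) (hΦ : IsFlow (jumpGenerator ν) c s T Φ) (hs : 0 ≤ s) (hst : s ≤ t) (htT : t ≤ T) :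
    Φ s (u s) = Φ t (u t) + ∫ r in s..t, Φ r (w r) := by
  have hsub : Icc s T ⊆ Icc 0 T := Icc_subset_Icc_left hs
  exact hΦ.eq_add_integral hc (fun r hr => h.norm_le r (hsub hr))
    (fun r hr r' hr' => h.lipschitz r (hsub hr) r' (hsub hr'))
    (fun r hr r' hr' => h.taylor r (hsub hr) r' (hsub hr'))
    (h.continuousOn_source.mono hsub) hst htT

end IsBackwardSolution

/-- The constant in the bound on the local truncation error. -/
noncomputable def truncationConst (T Λ M : ℝ) : ℝ :=
  6 * Λ ^ 2 * M + 2 * Λ * (M * (1 + evolLip T (2 * Λ) M)) +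
    (M * (1 + evolLip T (2 * Λ) M) ^ 2 + M * evolLip' T (2 * Λ) M)

/-! ### Transition functionals of the forward process and the local truncation error. -/

section Flow

variable {Ω : Type*} [mΩ : MeasurableSpace Ω] {P : Measure Ω} [IsProbabilityMeasure P]
  {ℱ : Filtration ℝ≥0 mΩ} {N : Ω → Measure (ℝ × ℝ)} {T : ℝ} {ν : Measure ℝ} [IsFiniteMeasure ν]

omit [IsProbabilityMeasure P] [IsFiniteMeasure ν] in
lemma IsPoissonRandomMeasure.measurable_jumpSum
    (hN : IsPoissonRandomMeasure N (timeJump T ν) P) (s t : ℝ) : Measurable (jumpSum N s t) :=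
  (measurable_integral_measure measurable_snd).comp
    ((measurable_measure_restrict (measurableSet_Ioc.prod .univ)).comp hN.measurable)

namespace IsPoissonRandomMeasureFor

/-- The weighted transition functionals of the forward process form a flow. -/
lemma exists_isFlow (hN : IsPoissonRandomMeasureFor ℱ N (timeJump T ν) P) {s : ℝ≥0}
    {ξ Z : Ω → ℝ} (hξ : Measurable[ℱ s] ξ) (hZ : Measurable[ℱ s] Z) (hZb : ∀ ω, |Z ω| ≤ 1) :
    ∃ Φ : ℝ → (ℝ →ᵇ ℝ) →L[ℝ] ℝ, IsFlow (jumpGenerator ν) (6 * ν.real univ ^ 2) s T Φ ∧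
      ∀ r v, Φ r v = ∫ ω, Z ω * v (ξ ω + jumpSum N s r ω) ∂P := by
  have hZ' := hZ.mono (ℱ.le s) le_rfl
  have hξ' := hξ.mono (ℱ.le s) le_rfl
  have hint : ∀ r (v : ℝ →ᵇ ℝ), Integrable (fun ω => Z ω * v (ξ ω + jumpSum N s r ω)) P :=
    fun r v => integrable_mul_comp hZ'
      (hξ'.add (hN.toIsPoissonRandomMeasure.measurable_jumpSum s r))
      hZb v
  have hbd : ∀ r (v : ℝ →ᵇ ℝ), ‖∫ ω, Z ω * v (ξ ω + jumpSum N s r ω) ∂P‖ ≤ 1 * ‖v‖ := by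
    intro r v
    have := norm_integral_le_of_norm_le_const (μ := P)
      (f := fun ω => Z ω * v (ξ ω + jumpSum N s r ω)) (C := 1 * ‖v‖)
      (Eventually.of_forall fun ω => by
        rw [norm_mul]
        exact mul_le_mul (hZb ω) (v.norm_coe_le_norm _) (norm_nonneg _) zero_le_one)
    simpa using this
  refine ⟨fun r => LinearMap.mkContinuous
    { toFun := fun v => ∫ ω, Z ω * v (ξ ω + jumpSum N s r ω) ∂P
      map_add' := fun v w => by
        rw [← integral_add (hint r v) (hint r w)]
        exact integral_congr_ae (Eventually.of_forall fun ω => by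
          simp only [BoundedContinuousFunction.coe_add, Pi.add_apply]; ring)
      map_smul' := fun c v => by
        rw [RingHom.id_apply, smul_eq_mul, ← integral_const_mul]
        exact integral_congr_ae (Eventually.of_forall fun ω => by
          simp only [BoundedContinuousFunction.coe_smul, smul_eq_mul]; ring) } 1 (hbd r),
    ⟨fun r v => ?_, fun r r' hr hrr hr' v => ?_⟩, fun r v => rfl⟩
  · exact (hbd r v).trans (le_of_eq (one_mul _))
  · lift r to ℝ≥0 using s.coe_nonneg.trans hr
    lift r' to ℝ≥0 using r.coe_nonneg.trans hrr
    have hr1 : s ≤ r := by exact_mod_cast hr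
    have hrr1 : r ≤ r' := by exact_mod_cast hrr
    -- The Markov property: the position at time `r` is `ℱ r`-measurable and serves as a new
    -- starting point.
    have h := hN.abs_integral_comp_add_jumpSum_sub_le hrr1 hr'
      (ξ := fun ω => ξ ω + jumpSum N s r ω) (Z := Z)
      ((hξ.mono (ℱ.mono hr1) le_rfl).add (hN.measurable_jumpSum s r))
      (hZ.mono (ℱ.mono hr1) le_rfl) hZb v
    have e : ∫ ω, Z ω * v (ξ ω + jumpSum N s r ω + jumpSum N r r' ω) ∂P =
        ∫ ω, Z ω * v (ξ ω + jumpSum N s r' ω) ∂P := by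
      refine integral_congr_ae ?_
      filter_upwards [hN.ae_jumpSum_add hr hrr] with ω hω
      rw [add_assoc, hω]
    rw [e] at h
    exact h

/-- The local truncation error of the Crank–Nicolson step. -/
lemma abs_truncation_le (hN : IsPoissonRandomMeasureFor ℱ N (timeJump T ν) P) {M : ℝ} {φ : ℝ → ℝ}
    {f : ℝ → ℝ → ℝ → ℝ} (hf : IsRegularGenerator T M f) {u w : ℝ → ℝ →ᵇ ℝ}
    (hu : IsBackwardSolution ν T M φ f u w) {a b : ℝ} (ha : 0 ≤ a) (hab : a ≤ b) (hbT : b ≤ T)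
    (x : ℝ) :
    |u a x - (∫ ω, u b (x + jumpSum N a b ω) ∂P
      + (b - a) / 2 * ∫ ω, f b (x + jumpSum N a b ω) (u b (x + jumpSum N a b ω)) ∂P
      + (b - a) / 2 * f a x (u a x))| ≤ truncationConst T (ν.real univ) M * (b - a) ^ 3 := by
  lift a to ℝ≥0 using ha
  have haT : (a : ℝ) ∈ Icc 0 T := ⟨a.coe_nonneg, hab.trans hbT⟩
  have hbT' : b ∈ Icc 0 T := ⟨a.coe_nonneg.trans hab, hbT⟩
  have hM := hf.nonneg (haT.1.trans haT.2)
  -- With unit weight and deterministic start, `Φ` is the transition operator evaluated at `x`.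
  obtain ⟨Φ, hΦ, hΦe⟩ := hN.exists_isFlow (s := a) (ξ := fun _ => x) (Z := fun _ => 1)
    measurable_const measurable_const (fun _ => by simp)
  have hc : 0 ≤ 6 * ν.real univ ^ 2 := by positivity
  have hΦa : ∀ v : ℝ →ᵇ ℝ, Φ a v = v x := by
    intro v
    rw [hΦe]
    simp [jumpSum_self]
  have hΦb : Φ b (u b) = ∫ ω, u b (x + jumpSum N a b ω) ∂P := by
    rw [hΦe]; simp
  have hΦb' : Φ b (w b) = ∫ ω, f b (x + jumpSum N a b ω) (u b (x + jumpSum N a b ω)) ∂P := by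
    rw [hΦe]; simp [hu.source b hbT']
  have hmain := hu.eq_add_integral hc hΦ a.coe_nonneg hab hbT
  set B₁ := evolLip T (2 * ν.real univ) M with hB₁
  set B₂ := evolLip' T (2 * ν.real univ) M with hB₂
  have hsub : Icc (a : ℝ) b ⊆ Icc 0 T := Icc_subset_Icc a.coe_nonneg hbT
  obtain ⟨p, q, hq, hpq⟩ := hf.taylor a haT x (u a x)
  set d : ℝ := (jumpGenerator ν (u a) + w a) x with hd
  -- By the equation `-d` is the time derivative of `u` at `(a, x)`, so `p - q d` is that of `f (·,
  -- x, u (·, x))` by the chain rule.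
  have htay : ∀ r ∈ Icc (a : ℝ) b, |Φ a (w r - w a) - (r - a) * (p - q * d)| ≤
      (M * (1 + B₁) ^ 2 + M * B₂) * (r - a) ^ 2 := by
    intro r hr
    have hpos : 0 ≤ r - a := sub_nonneg.2 hr.1
    rw [hΦa, BoundedContinuousFunction.coe_sub, Pi.sub_apply, hu.source r (hsub hr),
      hu.source a haT]
    have h1 := hpq r (hsub hr) (u r x)
    have h2 : |u r x - u a x| ≤ B₁ * (r - a) := by
      have h := hu.lipschitz a haT r (hsub hr)
      rw [abs_of_nonneg hpos] at h
      exact ((u r - u a).norm_coe_le_norm x).trans h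
    have h3 : |u r x - u a x + (r - a) * d| ≤ B₂ * (r - a) ^ 2 :=
      ((u r - u a + (r - a : ℝ) • (jumpGenerator ν (u a) + w a)).norm_coe_le_norm x).trans
        (hu.taylor a haT r (hsub hr))
    rw [abs_of_nonneg hpos] at h1
    have h4 : M * (r - a + |u r x - u a x|) ^ 2 ≤ M * ((r - a) + B₁ * (r - a)) ^ 2 := by
      gcongr
    have h5 : |q * (u r x - u a x + (r - a) * d)| ≤ M * (B₂ * (r - a) ^ 2) := by
      rw [abs_mul]
      exact mul_le_mul hq h3 (abs_nonneg _) hM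
    calc _ = |(f r x (u r x) - f a x (u a x) - (p * (r - a) + q * (u r x - u a x))) +
            q * (u r x - u a x + (r - a) * d)| := by ring_nf
      _ ≤ M * ((r - a) + B₁ * (r - a)) ^ 2 + M * (B₂ * (r - a) ^ 2) :=
          (abs_add_le _ _).trans (add_le_add (h1.trans h4) h5)
      _ = _ := by ring
  have hB₁0 : 0 ≤ M * (1 + B₁) := by
    have hT0 : 0 ≤ T := haT.1.trans haT.2
    rw [hB₁]; unfold evolLip evolBound; positivity
  have hG : ∀ r ∈ Icc (a : ℝ) b,
      |Φ r (w r) - Φ a (w a) - (Φ a (jumpGenerator ν (w a)) + (p - q * d)) *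
      (r - a)| ≤ truncationConst T (ν.real univ) M * (r - a) ^ 2 := by
    intro r hr
    have hw₁ : ‖w r - w a‖ ≤ M * (1 + B₁) * (r - a) := by
      have h := hu.norm_source_sub_le a haT r (hsub hr)
      rwa [abs_of_nonneg (sub_nonneg.2 hr.1)] at h
    refine (hΦ.abs_sub_sub_le hc hr.1 (hr.2.trans hbT) (hu.norm_source_le r) hw₁
      (htay r hr)).trans ?_
    unfold truncationConst
    gcongr
    exact norm_jumpGenerator_le ν
  have hcont : ContinuousOn (fun r => Φ r (w r)) (Icc a b) :=
    (hΦ.continuousOn hc (hu.continuousOn_source.mono (Icc_subset_Icc_left a.coe_nonneg))).mono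
      (Icc_subset_Icc_right hbT)
  have htrap := abs_integral_sub_trapezoid_le hab hcont hG
  rw [hΦa, hΦb'] at htrap
  rw [hΦa, hΦb] at hmain
  rw [hu.source a haT] at htrap
  refine le_trans (le_of_eq ?_) htrap
  congr 1
  linear_combination hmain

end IsPoissonRandomMeasureFor

end Flow

/-! ### Global error of the scheme -/

section Scheme

variable {Ω : Type*} [mΩ : MeasurableSpace Ω] {P : Measure Ω} [IsProbabilityMeasure P]
  {ℱ : Filtration ℝ≥0 mΩ} {N : Ω → Measure (ℝ × ℝ)} {T : ℝ} {ν : Measure ℝ} [IsFiniteMeasure ν]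

lemma gridTime_self (T : ℝ) {K : ℕ} (hK : 0 < K) : gridTime T K K = T := by
  unfold gridTime
  field_simp

lemma gridTime_succ_sub (T : ℝ) (K n : ℕ) : gridTime T K (n + 1) - gridTime T K n = T / K := by
  unfold gridTime
  push_cast
  ring

lemma gridTime_mem_Icc {T : ℝ} (hT : 0 ≤ T) {K n : ℕ} (hK : 0 < K) (hn : n ≤ K) :
    gridTime T K n ∈ Icc 0 T := by
  have hn' : (n : ℝ) ≤ K := by exact_mod_cast hn
  refine ⟨by unfold gridTime; positivity, ?_⟩
  refine le_trans ?_ (gridTime_self T hK).le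
  unfold gridTime
  gcongr

/-- One step of the error recursion. -/
lemma IsThetaScheme.abs_sub_step_le (hN : IsPoissonRandomMeasureFor ℱ N (timeJump T ν) P)
    (hT : 0 ≤ T) {M : ℝ} {φ : ℝ → ℝ} {f : ℝ → ℝ → ℝ → ℝ} (hf : IsRegularGenerator T M f)
    {u w : ℝ → ℝ →ᵇ ℝ} (hu : IsBackwardSolution ν T M φ f u w) {K : ℕ} (hK : 0 < K)
    (hMK : M * (T / K) ≤ 1) {y : ℕ → ℝ → ℝ} (hy : IsThetaScheme P N (1 / 2) T φ f K y) {n : ℕ}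
    (hn : n < K) {ε : ℝ} (hε : ∀ x, |u (gridTime T K (n + 1)) x - y (n + 1) x| ≤ ε) (x : ℝ) :
    |u (gridTime T K n) x - y n x| ≤ (1 + 2 * (M * (T / K))) * ε +
      2 * truncationConst T (ν.real univ) M * (T / K) ^ 3 := by
  have hM := hf.nonneg hT
  set a := gridTime T K n
  set b := gridTime T K (n + 1)
  set h : ℝ := T / K
  have hh : 0 ≤ h := by positivity
  have hba : b - a = h := gridTime_succ_sub T K n
  have ha : a ∈ Icc 0 T := gridTime_mem_Icc hT hK hn.le
  have hb : b ∈ Icc 0 T := gridTime_mem_Icc hT hK hn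
  have hε0 : 0 ≤ ε := (abs_nonneg _).trans (hε 0)
  have htr := hN.abs_truncation_le hf hu ha.1 (by linarith) hb.2 x
  have hst := hy.step n hn x
  have hi1 := hy.integrable_value n hn x
  have hi2 := hy.integrable_generator n hn x
  rw [hba] at htr
  have hJ : Measurable (fun ω => x + jumpSum N a b ω) :=
    (hN.toIsPoissonRandomMeasure.measurable_jumpSum a b).const_add x
  have hbc : ∀ v : ℝ →ᵇ ℝ, Integrable (fun ω => v (x + jumpSum N a b ω)) P := fun v =>
    Integrable.of_bound (v.continuous.measurable.comp hJ).aestronglyMeasurable ‖v‖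
      (Eventually.of_forall fun _ => v.norm_coe_le_norm _)
  have hw : Integrable (fun ω => f b (x + jumpSum N a b ω) (u b (x + jumpSum N a b ω))) P := by
    have := hbc (w b)
    simpa only [hu.source b hb] using this
  have d1 : |∫ ω, u b (x + jumpSum N a b ω) ∂P - ∫ ω, y (n + 1) (x + jumpSum N a b ω) ∂P| ≤ ε := by
    rw [← integral_sub (hbc _) hi1, ← Real.norm_eq_abs]
    have := norm_integral_le_of_norm_le_const (μ := P)
      (f := fun ω => u b (x + jumpSum N a b ω) - y (n + 1) (x + jumpSum N a b ω)) (C := ε)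
      (Eventually.of_forall fun ω => hε _)
    simpa using this
  have d2 : |∫ ω, f b (x + jumpSum N a b ω) (u b (x + jumpSum N a b ω)) ∂P -
      ∫ ω, f b (x + jumpSum N a b ω) (y (n + 1) (x + jumpSum N a b ω)) ∂P| ≤ M * ε := by
    rw [← integral_sub hw hi2, ← Real.norm_eq_abs]
    have := norm_integral_le_of_norm_le_const (μ := P)
      (f := fun ω => f b (x + jumpSum N a b ω) (u b (x + jumpSum N a b ω)) -
        f b (x + jumpSum N a b ω) (y (n + 1) (x + jumpSum N a b ω))) (C := M * ε)
      (Eventually.of_forall fun ω => by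
        refine (hf.lipschitz b hb b hb _ _ _ _).trans ?_
        simp only [sub_self, abs_zero, zero_add]
        exact mul_le_mul_of_nonneg_left (hε _) hM)
    simpa using this
  have d3 : |f a x (u a x) - f a x (y n x)| ≤ M * |u a x - y n x| := by
    refine (hf.lipschitz a ha a ha _ _ _ _).trans ?_
    simp
  set I₁ := ∫ ω, u b (x + jumpSum N a b ω) ∂P
  set I₂ := ∫ ω, y (n + 1) (x + jumpSum N a b ω) ∂P
  set J₁ := ∫ ω, f b (x + jumpSum N a b ω) (u b (x + jumpSum N a b ω)) ∂P
  set J₂ := ∫ ω, f b (x + jumpSum N a b ω) (y (n + 1) (x + jumpSum N a b ω)) ∂P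
  set C := truncationConst T (ν.real univ) M
  set e := |u a x - y n x| with he
  have e2 : |h / 2 * (J₁ - J₂)| ≤ h / 2 * (M * ε) := by
    rw [abs_mul, abs_of_nonneg (by positivity : 0 ≤ h / 2)]
    gcongr
  have e3 : |h / 2 * (f a x (u a x) - f a x (y n x))| ≤ h / 2 * (M * e) := by
    rw [abs_mul, abs_of_nonneg (by positivity : 0 ≤ h / 2)]
    gcongr
  have hmain : e ≤ C * h ^ 3 + (ε + h / 2 * (M * ε) + h / 2 * (M * e)) := by
    have : u a x - y n x = (u a x - (I₁ + h / 2 * J₁ + h / 2 * f a x (u a x))) +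
        ((I₁ - I₂) + h / 2 * (J₁ - J₂) + h / 2 * (f a x (u a x) - f a x (y n x))) := by
      linear_combination -hst
    refine (congrArg abs this).le.trans ?_
    exact (abs_add_le _ _).trans (add_le_add htr ((abs_add_three _ _ _).trans
      (add_le_add (add_le_add d1 e2) e3)))
  have hC : 0 ≤ C * h ^ 3 := (abs_nonneg _).trans htr
  have he0 : 0 ≤ e := abs_nonneg _
  set z := M * h
  have hz : 0 ≤ z := by positivity
  have h1 : (1 - z / 2) * e ≤ (1 + z / 2) * ε + C * h ^ 3 := by linear_combination hmain
  -- The implicit term is absorbed on the left. For `0 ≤ z ≤ 1`, `(1 - z/2)(1 + 2z) - (1 + z/2) = z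
  -- (1 - z) ≥ 0` and `2 (1 - z/2) ≥ 1`.
  have h2 : (1 - z / 2) * e ≤ (1 - z / 2) * ((1 + 2 * z) * ε + 2 * C * h ^ 3) := by
    have k1 : 0 ≤ z * (1 - z) * ε := by
      have : 0 ≤ 1 - z := by linarith
      positivity
    have k2 : 0 ≤ (1 - z) * (C * h ^ 3) := mul_nonneg (by linarith) hC
    nlinarith
  exact le_of_mul_le_mul_left h2 (by linarith)

/-- The global error of the scheme with respect to the solution of the nonlocal equation. -/
lemma IsThetaScheme.abs_sub_le (hN : IsPoissonRandomMeasureFor ℱ N (timeJump T ν) P)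
    (hT : 0 ≤ T) {M : ℝ} {φ : ℝ → ℝ} {f : ℝ → ℝ → ℝ → ℝ} (hf : IsRegularGenerator T M f)
    {u w : ℝ → ℝ →ᵇ ℝ} (hu : IsBackwardSolution ν T M φ f u w) {K : ℕ} (hK : 0 < K)
    (hMK : M * (T / K) ≤ 1) {y : ℕ → ℝ → ℝ} (hy : IsThetaScheme P N (1 / 2) T φ f K y) {n : ℕ}
    (hn : n ≤ K) (x : ℝ) :
    |u (gridTime T K n) x - y n x| ≤
      2 * truncationConst T (ν.real univ) M * T * Real.exp (2 * (M * T)) * (T / K) ^ 2 := by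
  have hM := hf.nonneg hT
  set C := truncationConst T (ν.real univ) M with hC
  have hC0 : 0 ≤ C := by
    have : 0 ≤ ν.real univ := measureReal_nonneg
    rw [hC]; unfold truncationConst evolLip' evolLip evolBound; positivity
  set h : ℝ := T / K with hh
  have hh0 : 0 ≤ h := by positivity
  have hz : 0 ≤ M * h := by positivity
  -- The index `j` counts steps back from the horizon, where the error is zero. Bounding each local
  -- error by the largest growth factor gives `j` equal terms instead of a geometric sum, and `K h =
  -- T` later trades one power of `h`.
  have hind : ∀ j ≤ K, ∀ x, |u (gridTime T K (K - j)) x - y (K - j) x| ≤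
      2 * C * h ^ 3 * j * (1 + 2 * (M * h)) ^ j := by
    intro j
    induction j with
    | zero =>
      intro _ x
      rw [Nat.sub_zero, gridTime_self T hK, hu.terminal, hy.terminal]
      simp
    | succ j ih =>
      intro hj x
      have hlt : K - (j + 1) < K := by omega
      have hsucc : K - (j + 1) + 1 = K - j := by omega
      have hstep := IsThetaScheme.abs_sub_step_le hN hT hf hu hK hMK hy hlt
        (by rw [hsucc]; exact ih (by omega)) x
      refine hstep.trans ?_
      have h1 : (1 : ℝ) ≤ (1 + 2 * (M * h)) ^ (j + 1) := one_le_pow₀ (by linarith)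
      have h2 : 2 * C * h ^ 3 * 1 ≤ 2 * C * h ^ 3 * (1 + 2 * (M * h)) ^ (j + 1) := by gcongr
      push_cast
      rw [← hC, ← hh]
      calc (1 + 2 * (M * h)) * (2 * C * h ^ 3 * j * (1 + 2 * (M * h)) ^ j) + 2 * C * h ^ 3
          = 2 * C * h ^ 3 * j * (1 + 2 * (M * h)) ^ (j + 1) + 2 * C * h ^ 3 * 1 := by ring
        _ ≤ 2 * C * h ^ 3 * j * (1 + 2 * (M * h)) ^ (j + 1) +
            2 * C * h ^ 3 * (1 + 2 * (M * h)) ^ (j + 1) := by gcongr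
        _ = _ := by ring
  have hfin := hind (K - n) (by omega) x
  rw [Nat.sub_sub_self hn] at hfin
  refine hfin.trans ?_
  have hKh : (K : ℝ) * h = T := by rw [hh]; field_simp
  have hj : ((K - n : ℕ) : ℝ) ≤ K := by exact_mod_cast Nat.sub_le K n
  have hexp : (1 + 2 * (M * h)) ^ (K - n) ≤ Real.exp (2 * (M * T)) := by
    calc (1 + 2 * (M * h)) ^ (K - n) ≤ (1 + 2 * (M * h)) ^ K :=
          pow_le_pow_right₀ (by linarith) (Nat.sub_le K n)
      _ ≤ (Real.exp (2 * (M * h))) ^ K := by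
          gcongr
          rw [add_comm]
          exact Real.add_one_le_exp _
      _ = _ := by
          rw [← Real.exp_nat_mul, ← hKh]
          congr 1
          ring
  calc _ ≤ 2 * C * h ^ 3 * K * Real.exp (2 * (M * T)) := by gcongr
    _ = 2 * C * (K * h) * Real.exp (2 * (M * T)) * h ^ 2 := by ring
    _ = _ := by rw [hKh]

end Scheme

/-! ### Regularity of the data -/

lemma CbWith.norm_le {E : Type*} [NormedAddCommGroup E] [NormedSpace ℝ E] {k : ℕ} {D : Set E}
    {ψ : E → ℝ} {M : ℝ} (h : CbWith k D ψ M) {p : E} (hp : p ∈ D) : ‖ψ p‖ ≤ M := by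
  have := h.2 0 (Nat.zero_le k) p hp
  rwa [norm_iteratedFDerivWithin_zero] at this

section CbTwo

variable {E : Type*} [NormedAddCommGroup E] [NormedSpace ℝ E] {D : Set E} {ψ : E → ℝ} {M : ℝ}

lemma CbWith.norm_fderivWithin_le (h : CbWith 2 D ψ M) (hD : UniqueDiffOn ℝ D) {p : E}
    (hp : p ∈ D) : ‖fderivWithin ℝ ψ D p‖ ≤ M := by
  have := h.2 1 (by norm_num) p hp
  rwa [norm_iteratedFDerivWithin_one _ (hD p hp)] at this

lemma CbWith.norm_sub_le (h : CbWith 2 D ψ M) (hD : UniqueDiffOn ℝ D) (hc : Convex ℝ D) {p p' : E}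
    (hp : p ∈ D) (hp' : p' ∈ D) : ‖ψ p' - ψ p‖ ≤ M * ‖p' - p‖ :=
  hc.norm_image_sub_le_of_norm_fderivWithin_le (h.1.differentiableOn (by norm_num))
    (fun _ hz => h.norm_fderivWithin_le hD hz) hp hp'

lemma CbWith.norm_fderivWithin_sub_le (h : CbWith 2 D ψ M) (hD : UniqueDiffOn ℝ D)
    (hc : Convex ℝ D) {p p' : E} (hp : p ∈ D) (hp' : p' ∈ D) :
    ‖fderivWithin ℝ ψ D p' - fderivWithin ℝ ψ D p‖ ≤ M * ‖p' - p‖ := by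
  refine hc.norm_image_sub_le_of_norm_fderivWithin_le
    ((h.1.fderivWithin hD (m := 1) (by norm_num)).differentiableOn (by norm_num))
    (fun z hz => ?_) hp hp'
  have := h.2 2 le_rfl z hz
  rwa [← norm_iteratedFDerivWithin_fderivWithin hD hz,
    norm_iteratedFDerivWithin_one _ (hD z hz)] at this

/-- The mean value inequality on the segment, applied to `ψ` minus its linearisation, gives the
constant `M` instead of the sharp `M / 2`. -/
lemma CbWith.norm_taylor_le (h : CbWith 2 D ψ M) (hD : UniqueDiffOn ℝ D) (hc : Convex ℝ D)
    {p p' : E} (hp : p ∈ D) (hp' : p' ∈ D) :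
    ‖ψ p' - ψ p - fderivWithin ℝ ψ D p (p' - p)‖ ≤ M * ‖p' - p‖ ^ 2 := by
  have hM : 0 ≤ M := (norm_nonneg _).trans (h.norm_le hp)
  have hsub : segment ℝ p p' ⊆ D := hc.segment_subset hp hp'
  have := (convex_segment p p').norm_image_sub_le_of_norm_hasFDerivWithin_le'
    (f := ψ) (f' := fderivWithin ℝ ψ D) (φ := fderivWithin ℝ ψ D p) (C := M * ‖p' - p‖)
    (fun z hz => ((h.1.differentiableOn (by norm_num) z (hsub hz)).hasFDerivWithinAt).mono hsub)
    (fun z hz => (h.norm_fderivWithin_sub_le hD hc hp (hsub hz)).trans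
      (mul_le_mul_of_nonneg_left (norm_sub_le_of_mem_segment hz) hM))
    (left_mem_segment ℝ p p') (right_mem_segment ℝ p p')
  calc _ ≤ _ := this
    _ = _ := by ring

end CbTwo

lemma CbWith.isRegularGenerator {T M : ℝ} (hT : 0 < T) {f : ℝ → ℝ → ℝ → ℝ}
    (h : CbWith 2 (Icc (0 : ℝ) T ×ˢ (univ : Set (ℝ × ℝ)))
      (fun p : ℝ × ℝ × ℝ => f p.1 p.2.1 p.2.2) M) : IsRegularGenerator T M f := by
  have hD : UniqueDiffOn ℝ (Icc (0 : ℝ) T ×ˢ (univ : Set (ℝ × ℝ))) :=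
    (uniqueDiffOn_Icc hT).prod uniqueDiffOn_univ
  have hc : Convex ℝ (Icc (0 : ℝ) T ×ˢ (univ : Set (ℝ × ℝ))) := (convex_Icc 0 T).prod convex_univ
  have hM : 0 ≤ M := (norm_nonneg _).trans
    (h.norm_le (p := ((0 : ℝ), (0 : ℝ), (0 : ℝ))) ⟨left_mem_Icc.2 hT.le, trivial⟩)
  refine ⟨fun t ht x y => ?_, fun t ht t' ht' x x' y y' => ?_, fun t ht x y => ?_⟩
  · exact h.norm_le (p := (t, x, y)) ⟨ht, trivial⟩
  · refine (h.norm_sub_le hD hc (p := (t, x, y)) (p' := (t', x', y')) ⟨ht, trivial⟩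
      ⟨ht', trivial⟩).trans (mul_le_mul_of_nonneg_left ?_ hM)
    simp only [Prod.mk_sub_mk, Prod.norm_def, Real.norm_eq_abs]
    refine max_le ?_ (max_le ?_ ?_) <;>
      linarith [abs_nonneg (t' - t), abs_nonneg (x' - x), abs_nonneg (y' - y)]
  · set A := fderivWithin ℝ (fun p : ℝ × ℝ × ℝ => f p.1 p.2.1 p.2.2)
      (Icc (0 : ℝ) T ×ˢ (univ : Set (ℝ × ℝ))) (t, x, y) with hA
    -- The coefficients are the partial derivatives in `t` and `y`; the `x` direction drops out
    -- because `x` is held fixed.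
    refine ⟨A (1, 0, 0), A (0, 0, 1), ?_, fun t' ht' y' => ?_⟩
    · have h1 := A.le_opNorm (0, 0, 1)
      have h2 : ‖((0 : ℝ), (0 : ℝ), (1 : ℝ))‖ = 1 := by simp [Prod.norm_def]
      rw [h2, mul_one] at h1
      exact h1.trans (h.norm_fderivWithin_le hD ⟨ht, trivial⟩)
    · have h1 := h.norm_taylor_le hD hc (p := (t, x, y)) (p' := (t', x, y')) ⟨ht, trivial⟩
        ⟨ht', trivial⟩
      have h2 : ((t', x, y') : ℝ × ℝ × ℝ) - (t, x, y) =
          (t' - t) • ((1 : ℝ), (0 : ℝ), (0 : ℝ)) + (y' - y) • ((0 : ℝ), (0 : ℝ), (1 : ℝ)) := by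
        ext <;> simp
      have h3 : ‖((t', x, y') : ℝ × ℝ × ℝ) - (t, x, y)‖ ≤ |t' - t| + |y' - y| := by
        simp only [Prod.mk_sub_mk, Prod.norm_def, Real.norm_eq_abs, sub_self, abs_zero]
        refine max_le ?_ (max_le ?_ ?_) <;> linarith [abs_nonneg (t' - t), abs_nonneg (y' - y)]
      rw [← hA] at h1
      have h4 : A (((t', x, y') : ℝ × ℝ × ℝ) - (t, x, y)) =
          A (1, 0, 0) * (t' - t) + A (0, 0, 1) * (y' - y) := by
        rw [h2, map_add, map_smul, map_smul, smul_eq_mul, smul_eq_mul]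
        ring
      rw [h4] at h1
      exact h1.trans (by gcongr)

/-! ### Identification of the solution of the backward equation -/

/-- A bounded nonnegative function dominated by a multiple of its backward integral vanishes. -/
lemma eq_zero_of_le_mul_integral {D : ℝ → ℝ} {M B T : ℝ} (hM : 0 ≤ M)
    (h0 : ∀ t ∈ Icc 0 T, 0 ≤ D t) (hB : ∀ t ∈ Icc 0 T, D t ≤ B)
    (h : ∀ t ∈ Icc 0 T, D t ≤ M * ∫ s in t..T, D s) : ∀ t ∈ Icc 0 T, D t = 0 := by
  -- Iterating the inequality produces factorial decay. Integrability of `D` is not needed: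
  -- comparison of nonnegative integrands asks it only of the polynomial majorant.
  have hn : ∀ n : ℕ, ∀ t ∈ Icc 0 T, D t ≤ B * ((M * (T - t)) ^ n / n.factorial) := by
    intro n
    induction n with
    | zero => intro t ht; simpa using hB t ht
    | succ n ih =>
      intro t ht
      have hsub : ∀ s ∈ Ioc t T, s ∈ Icc 0 T := fun s hs => ⟨ht.1.trans hs.1.le, hs.2⟩
      have hle : ∫ s in t..T, D s ≤ ∫ s in t..T, B * ((M * (T - s)) ^ n / n.factorial) := by
        rw [intervalIntegral.integral_of_le ht.2, intervalIntegral.integral_of_le ht.2]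
        refine integral_mono_of_nonneg ?_ ?_ ?_
        · exact (ae_restrict_iff' measurableSet_Ioc).2
            (Eventually.of_forall fun s hs => h0 s (hsub s hs))
        · exact (Continuous.intervalIntegrable (by fun_prop) t T).1
        · exact (ae_restrict_iff' measurableSet_Ioc).2
            (Eventually.of_forall fun s hs => ih s (hsub s hs))
      have he : ∫ s in t..T, B * ((M * (T - s)) ^ n / n.factorial) =
          B * M ^ n / n.factorial * ((T - t) ^ (n + 1) / (n + 1)) := by
        have : ∀ s, B * ((M * (T - s)) ^ n / n.factorial) =
            B * M ^ n / n.factorial * (T - s) ^ n := fun s => by rw [mul_pow]; ring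
        simp only [this]
        rw [intervalIntegral.integral_const_mul,
          intervalIntegral.integral_comp_sub_left (fun x => x ^ n), integral_pow]
        simp
      refine (h t ht).trans ((mul_le_mul_of_nonneg_left (hle.trans he.le) hM).trans (le_of_eq ?_))
      rw [Nat.factorial_succ]
      push_cast
      rw [mul_pow, pow_succ M]
      field_simp
  intro t ht
  have hlim : Tendsto (fun n : ℕ => B * ((M * (T - t)) ^ n / n.factorial)) atTop (𝓝 (B * 0)) :=
    (FloorSemiring.tendsto_pow_div_factorial_atTop (M * (T - t))).const_mul B
  rw [mul_zero] at hlim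
  exact le_antisymm (ge_of_tendsto hlim (Eventually.of_forall fun n => hn n t ht)) (h0 t ht)

/-- A process with càdlàg paths on `[0, T]` is jointly measurable. -/
lemma measurable_of_isCadlagOn {Ω : Type*} [MeasurableSpace Ω] {T : ℝ} (hT : 0 ≤ T)
    {Y : ℝ → Ω → ℝ} (hm : ∀ t ∈ Icc 0 T, Measurable (Y t))
    (hc : ∀ ω, IsCadlagOn T (fun t => Y t ω)) :
    Measurable (fun q : ℝ × Ω => Y (projIcc 0 T hT q.1) q.2) := by
  -- Grid points to the right of the current time, capped at `T`. The `+ 1` in the numerator keeps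
  -- the approximation on the side where the paths are continuous, and for each `n` only countably
  -- many times occur.
  set r : ℕ → ℕ → ℝ := fun n k => min T ((k + 1) / (n + 1)) with hr
  have hr0 : ∀ n k, r n k ∈ Icc 0 T := fun n k => ⟨le_min hT (by positivity), min_le_left _ _⟩
  set k : ℕ → ℝ → ℕ := fun n s => ⌊((n : ℝ) + 1) * (projIcc 0 T hT s : ℝ)⌋₊ with hk
  have hkm : ∀ n, Measurable (k n) := by
    intro n
    have h : Measurable fun s : ℝ => ((n : ℝ) + 1) * (projIcc 0 T hT s : ℝ) :=
      ((continuous_subtype_val.comp (continuous_projIcc (h := hT))).measurable).const_mul _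
    exact Nat.measurable_floor.comp h
  have hmeas : ∀ n, Measurable (fun q : ℝ × Ω => Y (r n (k n q.1)) q.2) := by
    intro n
    have h1 : Measurable (fun q : ℕ × Ω => Y (r n q.1) q.2) :=
      measurable_from_prod_countable_right fun j => hm _ (hr0 n j)
    exact h1.comp (((hkm n).comp measurable_fst).prodMk measurable_snd)
  refine measurable_of_tendsto_metrizable hmeas ?_
  rw [tendsto_pi_nhds]
  rintro ⟨s, ω⟩
  set s' : ℝ := ((projIcc 0 T hT s : Icc (0 : ℝ) T) : ℝ) with hs'
  have hs'm : s' ∈ Icc 0 T := (projIcc 0 T hT s).2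
  have hge : ∀ n, s' ≤ r n (k n s) := by
    intro n
    refine le_min hs'm.2 ?_
    rw [le_div_iff₀ (by positivity), mul_comm]
    exact (Nat.lt_floor_add_one _).le
  have hle : ∀ n : ℕ, r n (k n s) ≤ s' + 1 / ((n : ℝ) + 1) := by
    intro n
    refine (min_le_right _ _).trans ?_
    rw [add_div]
    gcongr
    rw [div_le_iff₀ (by positivity), mul_comm]
    exact Nat.floor_le (mul_nonneg (by positivity) hs'm.1)
  have hlim : Tendsto (fun n => r n (k n s)) atTop (𝓝[Icc s' T] s') := by
    refine tendsto_nhdsWithin_iff.2 ⟨?_, Eventually.of_forall fun n => ⟨hge n, min_le_left _ _⟩⟩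
    refine tendsto_of_tendsto_of_tendsto_of_le_of_le tendsto_const_nhds ?_ hge hle
    simpa using (tendsto_one_div_add_atTop_nhds_zero_nat (𝕜 := ℝ)).const_add s'
  exact ((hc ω s' hs'm).1.tendsto).comp hlim

section Identification

variable {Ω : Type*} [mΩ : MeasurableSpace Ω] {P : Measure Ω} [IsProbabilityMeasure P]
  {ℱ : Filtration ℝ≥0 mΩ} {N : Ω → Measure (ℝ × ℝ)} {T : ℝ}

section Forward

variable {ν : Measure ℝ} [IsFiniteMeasure ν] {X₀ : Ω → ℝ}

omit [IsProbabilityMeasure P] [IsFiniteMeasure ν] in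
lemma IsPoissonRandomMeasureFor.measurable_forwardProcess
    (hN : IsPoissonRandomMeasureFor ℱ N (timeJump T ν) P) (hX₀ : Measurable[ℱ 0] X₀) (t : ℝ≥0) :
    Measurable[ℱ t] (forwardProcess X₀ N t) :=
  (hX₀.mono (ℱ.mono (zero_le)) le_rfl).add (hN.measurable_jumpSum 0 t)

omit [IsProbabilityMeasure P] in
lemma IsPoissonRandomMeasureFor.ae_forwardProcess_add
    (hN : IsPoissonRandomMeasureFor ℱ N (timeJump T ν) P) {s t : ℝ} (hs : 0 ≤ s) (hst : s ≤ t) :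
    ∀ᵐ ω ∂P, forwardProcess X₀ N s ω + jumpSum N s t ω = forwardProcess X₀ N t ω := by
  filter_upwards [hN.ae_jumpSum_add hs hst] with ω hω
  unfold forwardProcess
  rw [add_assoc, hω]

omit [IsProbabilityMeasure P] in
/-- The forward process has a jointly measurable version. -/
lemma IsPoissonRandomMeasureFor.exists_measurable_forwardProcess
    (hN : IsPoissonRandomMeasureFor ℱ N (timeJump T ν) P) (hX₀ : Measurable X₀) :
    ∃ X : ℝ × Ω → ℝ, Measurable X ∧ ∀ᵐ ω ∂P, ∀ t, X (t, ω) = forwardProcess X₀ N t ω := by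
  have hN' := hN.toIsPoissonRandomMeasure
  -- The s-finite version of `N` makes the integral jointly measurable; the exceptional set does not
  -- depend on `t`.
  set κ : Kernel (ℝ × Ω) (ℝ × ℝ) := hN'.kernel.comap Prod.snd measurable_snd with hκ
  refine ⟨fun q => X₀ q.2 + ∫ p, (Ioc 0 q.1).indicator (fun _ => p.2) p.1 ∂(κ q), ?_, ?_⟩
  · refine (hX₀.comp measurable_snd).add (StronglyMeasurable.measurable ?_)
    refine StronglyMeasurable.integral_kernel_prod_right
      (f := fun (q : ℝ × Ω) (p : ℝ × ℝ) => (Ioc 0 q.1).indicator (fun _ => p.2) p.1) ?_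
    have h : (Function.uncurry fun (q : ℝ × Ω) (p : ℝ × ℝ) =>
        (Ioc 0 q.1).indicator (fun _ => p.2) p.1) =
        {z : (ℝ × Ω) × (ℝ × ℝ) | 0 < z.2.1 ∧ z.2.1 ≤ z.1.1}.indicator (fun z => z.2.2) := by
      ext z
      rfl
    rw [h]
    refine Measurable.stronglyMeasurable (Measurable.indicator measurable_snd.snd ?_)
    exact (measurableSet_lt measurable_const measurable_snd.fst).inter
      (measurableSet_le measurable_snd.fst measurable_fst.fst)
  · filter_upwards [hN'.ae_kernel_eq] with ω hω t
    simp only [hκ, Kernel.comap_apply, hω]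
    unfold forwardProcess jumpSum
    congr 1
    rw [← integral_indicator (measurableSet_Ioc.prod .univ)]
    refine integral_congr_ae (Eventually.of_forall fun p => ?_)
    simp [indicator]

end Forward

namespace IsBSDESolution

variable {γ : ℝ → ℝ} {φ : ℝ → ℝ} {f : ℝ → ℝ → ℝ → ℝ} {X Y : ℝ → Ω → ℝ}
  {U : ℝ → Ω → ℝ → ℝ}

omit [IsProbabilityMeasure P] in
lemma measurable (hY : IsBSDESolution P ℱ N γ T φ f X Y U) {t : ℝ} (ht : t ∈ Icc 0 T) :
    Measurable (Y t) := by
  have h := hY.adapted ⟨t, ht.1⟩ ht.2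
  exact h.mono (ℱ.le _) le_rfl

lemma ennreal_le_one_add_sq (a : ℝ≥0∞) : a ≤ 1 + a ^ 2 := by
  rcases le_total a 1 with h | h
  · exact h.trans le_self_add
  · calc a = a * 1 := (mul_one a).symm
      _ ≤ a * a := by gcongr
      _ = a ^ 2 := (sq a).symm
      _ ≤ _ := le_add_self

lemma exists_lintegral_le (hY : IsBSDESolution P ℱ N γ T φ f X Y U) :
    ∃ B : ℝ, 0 ≤ B ∧ ∀ t ∈ Icc 0 T, ∫⁻ ω, ‖Y t ω‖ₑ ∂P ≤ ENNReal.ofReal B := by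
  set S := ∫⁻ ω, (⨆ t ∈ Icc (0 : ℝ) T, ‖Y t ω‖ₑ) ^ 2 ∂P with hS
  have hSfin : 1 + S ≠ ∞ := ENNReal.add_ne_top.2 ⟨ENNReal.one_ne_top, hY.sup_sq.ne⟩
  refine ⟨(1 + S).toReal, ENNReal.toReal_nonneg, fun t ht => ?_⟩
  rw [ENNReal.ofReal_toReal hSfin]
  calc ∫⁻ ω, ‖Y t ω‖ₑ ∂P ≤ ∫⁻ ω, (1 + (⨆ t ∈ Icc (0 : ℝ) T, ‖Y t ω‖ₑ) ^ 2) ∂P := by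
        refine lintegral_mono fun ω => (ennreal_le_one_add_sq _).trans ?_
        gcongr
        exact le_iSup₂ (f := fun t (_ : t ∈ Icc (0 : ℝ) T) => ‖Y t ω‖ₑ) t ht
    _ = 1 + S := by rw [lintegral_add_left measurable_const]; simp [hS]

/-- The intensity is finite, so square integrability gives integrability, which is what the
compensation formula asks of `U`. -/
lemma lintegral_integrand_lt_top [IsFiniteMeasure (jumpMeasure γ)]
    (hY : IsBSDESolution P ℱ N γ T φ f X Y U) :
    ∫⁻ ω, (∫⁻ r in Icc (0 : ℝ) T, (∫⁻ e, ‖U r ω e‖ₑ ∂(jumpMeasure γ))) ∂P < ∞ := by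
  have hle : ∫⁻ ω, (∫⁻ r in Icc (0 : ℝ) T, (∫⁻ e, ‖U r ω e‖ₑ ∂(jumpMeasure γ))) ∂P ≤
      ∫⁻ ω, (∫⁻ r in Icc (0 : ℝ) T, (∫⁻ e, (1 + ‖U r ω e‖ₑ ^ 2) ∂(jumpMeasure γ))) ∂P :=
    lintegral_mono fun ω => lintegral_mono fun r => lintegral_mono fun e => ennreal_le_one_add_sq _
  refine hle.trans_lt ?_
  simp only [lintegral_add_left measurable_const]
  refine ENNReal.add_lt_top.2 ⟨?_, hY.sq_integrable⟩
  simp only [lintegral_const, measure_univ, mul_one, one_mul]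
  exact ENNReal.mul_lt_top (measure_lt_top _ _) (measure_lt_top _ _)

/-- The compensated integral in the backward equation is orthogonal to the past. -/
lemma integral_mul_compensatedIntegral [IsFiniteMeasure (jumpMeasure γ)]
    (hN : IsPoissonRandomMeasureFor ℱ N (timeJump T (jumpMeasure γ)) P)
    (hY : IsBSDESolution P ℱ N γ T φ f X Y U) {t : ℝ≥0} (ht : (t : ℝ) ≤ T) {Z : Ω → ℝ}
    (hZ : Measurable[ℱ t] Z) (hZb : ∀ ω, |Z ω| ≤ 1) :
    Integrable (fun ω => Z ω * compensatedIntegral γ N U t T ω) P ∧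
      ∫ ω, Z ω * compensatedIntegral γ N U t T ω ∂P = 0 := by
  lift T to ℝ≥0 using t.coe_nonneg.trans ht
  obtain ⟨h1, h2, h3⟩ := hN.integral_mul_setIntegral hY.predictable hY.lintegral_integrand_lt_top
    (by exact_mod_cast ht) le_rfl hZ hZb
  unfold compensatedIntegral
  simp only [mul_sub]
  exact ⟨h1.sub h2, by rw [integral_sub h1 h2, h3, sub_self]⟩

end IsBSDESolution

end Identification

open IsPoissonRandomMeasureFor

section Identification

variable {Ω : Type*} [mΩ : MeasurableSpace Ω] {P : Measure Ω} [IsProbabilityMeasure P]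
  {ℱ : Filtration ℝ≥0 mΩ} {N : Ω → Measure (ℝ × ℝ)} {T : ℝ} {γ : ℝ → ℝ} {φ : ℝ → ℝ}
  {f : ℝ → ℝ → ℝ → ℝ} {X₀ : Ω → ℝ} {Y : ℝ → Ω → ℝ} {U : ℝ → Ω → ℝ → ℝ}

/-- The solution of the backward equation tested against a bounded `ℱ t`-measurable weight. -/
lemma IsBSDESolution.integral_mul_eq [IsFiniteMeasure (jumpMeasure γ)]
    (hN : IsPoissonRandomMeasureFor ℱ N (timeJump T (jumpMeasure γ)) P) (hX₀ : Measurable[ℱ 0] X₀)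
    (hY : IsBSDESolution P ℱ N γ T φ f (forwardProcess X₀ N) Y U) {φ' : ℝ →ᵇ ℝ}
    (hφ' : ∀ x, φ' x = φ x) {t : ℝ≥0} (ht : (t : ℝ) ≤ T) {F : ℝ × Ω → ℝ} {M : ℝ}
    (hF : Measurable F) (hFM : ∀ q, |F q| ≤ M)
    (hFe : ∀ᵐ ω ∂P, ∀ s ∈ Icc 0 T, f s (forwardProcess X₀ N s ω) (Y s ω) = F (s, ω))
    {Z : Ω → ℝ} (hZ : Measurable[ℱ t] Z) (hZb : ∀ ω, |Z ω| ≤ 1) :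
    Integrable (fun ω => Z ω * Y t ω) P ∧
    Integrable (fun s => ∫ ω, Z ω * F (s, ω) ∂P) (volume.restrict (Ioc (t : ℝ) T)) ∧
    ∫ ω, Z ω * Y t ω ∂P = ∫ ω, Z ω * φ' (forwardProcess X₀ N T ω) ∂P +
      ∫ s in Ioc (t : ℝ) T, ∫ ω, Z ω * F (s, ω) ∂P := by
  have hZ' := hZ.mono (ℱ.le t) le_rfl
  have hT : 0 ≤ T := t.coe_nonneg.trans ht
  obtain ⟨hC, hC0⟩ := hY.integral_mul_compensatedIntegral hN ht hZ hZb
  have hXT : Measurable (forwardProcess X₀ N T) :=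
    (hN.measurable_forwardProcess hX₀ ⟨T, hT⟩).mono (ℱ.le _) le_rfl
  have hφi : Integrable (fun ω => Z ω * φ' (forwardProcess X₀ N T ω)) P :=
    integrable_mul_comp hZ' hXT hZb φ'
  -- The jointly measurable bounded version `F` of the generator along the solution makes Fubini's
  -- theorem applicable.
  have hprod : Integrable (fun q : ℝ × Ω => Z q.2 * F q)
      ((volume.restrict (Ioc (t : ℝ) T)).prod P) := by
    refine Integrable.of_bound ((hZ'.comp measurable_snd).mul hF).aestronglyMeasurable M
      (Eventually.of_forall fun q => ?_)
    rw [norm_mul]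
    calc _ ≤ 1 * M := mul_le_mul (hZb _) (hFM q) (abs_nonneg _) zero_le_one
      _ = M := one_mul M
  have hA : Integrable (fun ω => ∫ s in Ioc (t : ℝ) T, Z ω * F (s, ω)) P :=
    hprod.integral_prod_right
  have heq : (fun ω => Z ω * Y t ω) =ᵐ[P] fun ω => Z ω * φ' (forwardProcess X₀ N T ω) +
      (∫ s in Ioc (t : ℝ) T, Z ω * F (s, ω)) - Z ω * compensatedIntegral γ N U t T ω := by
    filter_upwards [hY.equation t ⟨t.coe_nonneg, ht⟩, hFe] with ω h1 h2
    rw [h1, hφ', integral_const_mul, intervalIntegral.integral_of_le ht,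
      setIntegral_congr_fun measurableSet_Ioc fun s hs => h2 s ⟨t.coe_nonneg.trans hs.1.le, hs.2⟩]
    ring
  refine ⟨((hφi.add hA).sub hC).congr heq.symm, hprod.integral_prod_left, ?_⟩
  have hφA : Integrable (fun ω => Z ω * φ' (forwardProcess X₀ N T ω) +
      ∫ s in Ioc (t : ℝ) T, Z ω * F (s, ω)) P := hφi.add hA
  rw [integral_congr_ae heq, integral_sub hφA hC, hC0, sub_zero, integral_add hφi hA]
  congr 1
  exact (integral_integral_swap hprod).symm

/-- The solution of the backward equation is the solution of the nonlocal equation along the forward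
process. -/
lemma IsBSDESolution.ae_eq [IsFiniteMeasure (jumpMeasure γ)]
    (hN : IsPoissonRandomMeasureFor ℱ N (timeJump T (jumpMeasure γ)) P) (hX₀ : Measurable[ℱ 0] X₀)
    (hY : IsBSDESolution P ℱ N γ T φ f (forwardProcess X₀ N) Y U) (hT : 0 ≤ T) {M : ℝ}
    (hf : IsRegularGenerator T M f) {u w : ℝ → ℝ →ᵇ ℝ}
    (hu : IsBackwardSolution (jumpMeasure γ) T M φ f u w) :
    ∀ t ∈ Icc 0 T, ∀ᵐ ω ∂P, Y t ω = u t (forwardProcess X₀ N t ω) := by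
  have hM := hf.nonneg hT
  obtain ⟨X, hXm, hX⟩ := hN.exists_measurable_forwardProcess (hX₀.mono (ℱ.le 0) le_rfl)
  obtain ⟨B, hB0, hB⟩ := hY.exists_lintegral_le
  set B' := evolBound T (2 * (jumpMeasure γ).real univ) M with hB'
  have hB'0 : 0 ≤ B' := (norm_nonneg _).trans (hu.norm_le 0 (left_mem_Icc.2 hT))
  set c : ℝ → ℝ := fun s => (projIcc 0 T hT s : Icc (0 : ℝ) T) with hc
  have hcI : ∀ s, c s ∈ Icc 0 T := fun s => (projIcc 0 T hT s).2
  have hce : ∀ s ∈ Icc 0 T, c s = s := fun s hs => by simp only [hc, projIcc_of_mem hT hs]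
  have hcc : Continuous c := continuous_subtype_val.comp continuous_projIcc
  have hYm : Measurable (fun q : ℝ × Ω => Y (c q.1) q.2) :=
    measurable_of_isCadlagOn hT (fun t ht => hY.measurable ht) hY.cadlag
  have hXcm : Measurable (fun q : ℝ × Ω => X (c q.1, q.2)) :=
    hXm.comp ((hcc.measurable.comp measurable_fst).prodMk measurable_snd)
  have huc : Continuous fun q : ℝ × ℝ => u (c q.1) q.2 :=
    continuous_eval.comp
      (((hu.continuousOn.comp_continuous hcc hcI).comp continuous_fst).prodMk continuous_snd)
  set F : ℝ × Ω → ℝ := fun q => f (c q.1) (X (c q.1, q.2)) (Y (c q.1) q.2) with hF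
  have hFm : Measurable F :=
    (hf.continuous_clamp hT).measurable.comp (measurable_fst.prodMk (hXcm.prodMk hYm))
  have hFM : ∀ q, |F q| ≤ M := fun q => hf.abs_le _ (hcI _) _ _
  have hFe : ∀ᵐ ω ∂P, ∀ s ∈ Icc 0 T, f s (forwardProcess X₀ N s ω) (Y s ω) = F (s, ω) := by
    filter_upwards [hX] with ω hω s hs
    simp only [hF, hce s hs, hω]
  set Δ : ℝ × Ω → ℝ := fun q => |Y (c q.1) q.2 - u (c q.1) (X (c q.1, q.2))| with hΔ
  have hΔm : Measurable Δ :=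
    continuous_abs.measurable.comp (hYm.sub (huc.measurable.comp (measurable_fst.prodMk hXcm)))
  have hΔ0 : ∀ q, 0 ≤ Δ q := fun q => abs_nonneg _
  have hΔB : ∀ s, ∫⁻ ω, ‖Δ (s, ω)‖ₑ ∂P ≤ ENNReal.ofReal (B + B') := by
    intro s
    calc ∫⁻ ω, ‖Δ (s, ω)‖ₑ ∂P ≤ ∫⁻ ω, (ENNReal.ofReal B' + ‖Y (c s) ω‖ₑ) ∂P := by
          refine lintegral_mono fun ω => ?_
          simp only [hΔ]
          rw [← Real.norm_eq_abs, enorm_norm, add_comm]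
          refine (enorm_sub_le).trans (add_le_add le_rfl ?_)
          rw [← ofReal_norm]
          exact ENNReal.ofReal_le_ofReal
            (((u (c s)).norm_coe_le_norm _).trans (hu.norm_le _ (hcI s)))
      _ = ENNReal.ofReal B' + ∫⁻ ω, ‖Y (c s) ω‖ₑ ∂P := by
          rw [lintegral_add_left measurable_const]; simp
      _ ≤ ENNReal.ofReal B' + ENNReal.ofReal B := by gcongr; exact hB _ (hcI s)
      _ = _ := by rw [← ENNReal.ofReal_add hB'0 hB0, add_comm]
  have hΔi : ∀ s, Integrable (fun ω => Δ (s, ω)) P := fun s =>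
    ⟨(hΔm.comp measurable_prodMk_left).aestronglyMeasurable, (hΔB s).trans_lt ENNReal.ofReal_lt_top⟩
  have hΔp : ∀ t, Integrable Δ ((volume.restrict (Ioc t T)).prod P) := by
    refine fun t => ⟨hΔm.aestronglyMeasurable, ?_⟩
    change ∫⁻ q, ‖Δ q‖ₑ ∂_ < ∞
    rw [lintegral_prod _ hΔm.enorm.aemeasurable]
    refine (lintegral_mono hΔB).trans_lt ?_
    rw [lintegral_const]
    exact ENNReal.mul_lt_top ENNReal.ofReal_lt_top (measure_lt_top _ _)
  set D : ℝ → ℝ := fun s => ∫ ω, Δ (s, ω) ∂P with hD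
  have hD0 : ∀ t ∈ Icc 0 T, 0 ≤ D t := fun t _ => integral_nonneg fun ω => hΔ0 _
  have hDB : ∀ t ∈ Icc 0 T, D t ≤ B + B' := by
    intro t _
    refine (le_abs_self _).trans ?_
    rw [← Real.norm_eq_abs]
    refine (norm_integral_le_lintegral_norm _).trans ?_
    simp only [ofReal_norm]
    exact ENNReal.toReal_le_of_le_ofReal (by positivity) (hΔB t)
  have hΔe : ∀ s ∈ Icc 0 T, ∀ᵐ ω ∂P, Δ (s, ω) = |Y s ω - u s (forwardProcess X₀ N s ω)| := by
    intro s hs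
    filter_upwards [hX] with ω hω
    simp only [hΔ, hce s hs, hω]
  have hDle : ∀ t ∈ Icc 0 T, D t ≤ M * ∫ s in t..T, D s := by
    intro t ht
    have htT := ht.2
    have ht0 := ht.1
    lift t to ℝ≥0 using ht0
    have hXt := hN.measurable_forwardProcess hX₀ t
    set V : Ω → ℝ := fun ω => Y t ω - u t (forwardProcess X₀ N t ω) with hV
    have hVm : Measurable[ℱ t] V := (hY.adapted t htT).sub ((u t).continuous.measurable.comp hXt)
    -- The sign of the difference is known at time `t`, so this weight is admissible and turns the
    -- tested difference into its mean absolute value.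
    set Z : Ω → ℝ := fun ω => if 0 ≤ V ω then 1 else -1 with hZdef
    have hZ : Measurable[ℱ t] Z :=
      Measurable.ite (hVm measurableSet_Ici) measurable_const measurable_const
    have hZb : ∀ ω, |Z ω| ≤ 1 := by
      intro ω
      simp only [hZdef]
      split_ifs <;> simp
    have hZV : ∀ ω, Z ω * V ω = |V ω| := by
      intro ω
      simp only [hZdef]
      split_ifs with h
      · rw [one_mul, abs_of_nonneg h]
      · rw [neg_one_mul, abs_of_neg (not_le.1 h)]
    have hZ' := hZ.mono (ℱ.le t) le_rfl
    obtain ⟨i1, i2, e1⟩ := hY.integral_mul_eq hN hX₀ hu.terminal htT hFm hFM hFe hZ hZb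
    obtain ⟨Φ, hΦ, hΦe⟩ := hN.exists_isFlow hXt hZ hZb
    have hcc0 : 0 ≤ 6 * (jumpMeasure γ).real univ ^ 2 := by positivity
    have hΦX : ∀ r ∈ Icc (t : ℝ) T, ∀ v, Φ r v = ∫ ω, Z ω * v (forwardProcess X₀ N r ω) ∂P := by
      intro r hr v
      rw [hΦe]
      refine integral_congr_ae ?_
      filter_upwards [hN.ae_forwardProcess_add (X₀ := X₀) t.coe_nonneg hr.1] with ω hω
      rw [hω]
    have hflow := hu.eq_add_integral hcc0 hΦ t.coe_nonneg htT le_rfl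
    rw [hΦX t (left_mem_Icc.2 htT), hΦX T (right_mem_Icc.2 htT),
      intervalIntegral.integral_of_le htT] at hflow
    have i3 : Integrable (fun r => Φ r (w r)) (volume.restrict (Ioc (t : ℝ) T)) :=
      ((hΦ.continuousOn hcc0 (hu.continuousOn_source.mono
        (Icc_subset_Icc_left t.coe_nonneg))).intervalIntegrable_of_Icc htT).1
    -- Both sources are `f` at the same `(s, X_s)`, so the Lipschitz bound in `y` alone controls
    -- their difference.
    have hpt : ∀ s ∈ Ioc (t : ℝ) T, (∫ ω, Z ω * F (s, ω) ∂P) - Φ s (w s) ≤ M * D s := by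
      intro s hs
      have hs0 : s ∈ Icc 0 T := ⟨t.coe_nonneg.trans hs.1.le, hs.2⟩
      have hXs : Measurable (forwardProcess X₀ N s) :=
        (hN.measurable_forwardProcess hX₀ ⟨s, hs0.1⟩).mono (ℱ.le _) le_rfl
      have j1 : Integrable (fun ω => Z ω * F (s, ω)) P := by
        refine Integrable.of_bound
          (hZ'.mul (hFm.comp measurable_prodMk_left)).aestronglyMeasurable M
          (Eventually.of_forall fun ω => ?_)
        rw [norm_mul]
        calc _ ≤ 1 * M := mul_le_mul (hZb _) (hFM _) (abs_nonneg _) zero_le_one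
          _ = M := one_mul M
      rw [hΦX s ⟨hs.1.le, hs.2⟩, ← integral_sub j1 (integrable_mul_comp hZ' hXs hZb _), hD,
        ← integral_const_mul]
      refine integral_mono_ae (j1.sub (integrable_mul_comp hZ' hXs hZb _)) ((hΔi s).const_mul M) ?_
      filter_upwards [hFe, hΔe s hs0] with ω h1 h2
      rw [h2, ← h1 s hs0, hu.source s hs0, ← mul_sub]
      refine (le_abs_self _).trans ?_
      rw [abs_mul]
      refine (mul_le_mul (hZb ω) (hf.lipschitz s hs0 s hs0 _ _ _ _) (abs_nonneg _)
        zero_le_one).trans (le_of_eq ?_)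
      simp
    calc D t = ∫ ω, Z ω * V ω ∂P := by
          refine integral_congr_ae ?_
          filter_upwards [hΔe t ht] with ω hω
          rw [hω, hZV]
      _ = ∫ ω, Z ω * Y t ω ∂P - ∫ ω, Z ω * u t (forwardProcess X₀ N t ω) ∂P := by
          rw [← integral_sub i1 (integrable_mul_comp hZ' (hXt.mono (ℱ.le t) le_rfl) hZb _)]
          refine integral_congr_ae (Eventually.of_forall fun ω => ?_)
          simp only [hV, mul_sub]
      _ = ∫ s in Ioc (t : ℝ) T, ((∫ ω, Z ω * F (s, ω) ∂P) - Φ s (w s)) := by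
          rw [e1, hflow, integral_sub i2 i3]
          ring
      _ ≤ ∫ s in Ioc (t : ℝ) T, M * D s := by
          refine setIntegral_mono_on (i2.sub i3) ?_ measurableSet_Ioc hpt
          exact (hΔp t).integral_prod_left.const_mul M
      _ = M * ∫ s in (t : ℝ)..T, D s := by
          rw [integral_const_mul, intervalIntegral.integral_of_le htT]
  have hzero := eq_zero_of_le_mul_integral hM hD0 hDB hDle
  intro t ht
  have h1 := (integral_eq_zero_iff_of_nonneg (fun ω => hΔ0 (t, ω)) (hΔi t)).1 (hzero t ht)
  filter_upwards [h1, hΔe t ht] with ω h2 h3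
  rw [h3] at h2
  exact sub_eq_zero.1 (abs_eq_zero.1 h2)

end Identification

lemma jumpMeasure_univ {γ : ℝ → ℝ} (hγ : ∀ e, 0 ≤ γ e) (hi : Integrable γ) :
    jumpMeasure γ univ = ENNReal.ofReal (∫ e, γ e) := by
  unfold jumpMeasure
  rw [withDensity_apply _ .univ, Measure.restrict_univ,
    ofReal_integral_eq_lintegral_ofReal hi (Eventually.of_forall hγ)]

end NonlocalBSDE

/-! ### The convergence theorem. -/

theorem theorem4p2 (T Λ M : ℝ) (hT : 0 < T) :
    ∃ C δ : ℝ, 0 < δ ∧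
      ∀ (γ : ℝ → ℝ), (∀ e, 0 ≤ γ e) → Integrable γ → (∫ e, γ e) = Λ →
      ∀ (φ : ℝ → ℝ), NonlocalBSDE.CbWith 2 Set.univ φ M →
      ∀ (f : ℝ → ℝ → ℝ → ℝ),
        NonlocalBSDE.CbWith 2 (Set.Icc (0 : ℝ) T ×ˢ (Set.univ : Set (ℝ × ℝ)))
          (fun p : ℝ × ℝ × ℝ => f p.1 p.2.1 p.2.2) M →
        NonlocalBSDE.UniformLipschitzDerivs 2 T f →
      ∀ (Ω : Type*) (mΩ : MeasurableSpace Ω) (P : Measure Ω), IsProbabilityMeasure P →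
      ∀ (ℱ : Filtration ℝ≥0 mΩ) (N : Ω → Measure (ℝ × ℝ)),
        NonlocalBSDE.IsPoissonRandomMeasureFor ℱ N (NonlocalBSDE.compensator T γ) P →
      ∀ (X₀ : Ω → ℝ), Measurable[ℱ 0] X₀ →
      ∀ (Y : ℝ → Ω → ℝ) (U : ℝ → Ω → ℝ → ℝ),
        NonlocalBSDE.IsBSDESolution P ℱ N γ T φ f (NonlocalBSDE.forwardProcess X₀ N) Y U →
      ∀ (K : ℕ), 0 < K → T / K ≤ δ →
      ∀ (y : ℕ → ℝ → ℝ), NonlocalBSDE.IsThetaScheme P N (1 / 2) T φ f K y →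
      ∀ n ≤ K,
        Integrable (fun ω => Y (NonlocalBSDE.gridTime T K n) ω
          - y n (NonlocalBSDE.forwardProcess X₀ N (NonlocalBSDE.gridTime T K n) ω)) P ∧
        ∫ ω, |Y (NonlocalBSDE.gridTime T K n) ω
          - y n (NonlocalBSDE.forwardProcess X₀ N (NonlocalBSDE.gridTime T K n) ω)| ∂P
          ≤ C * (T / K) ^ 2 := by
  open NonlocalBSDE in
  -- This `δ` is positive for every real `M` and forces `M Δt ≤ 1`, which the implicit step needs.
  -- The sign of `M` is not yet known here.
  refine ⟨2 * truncationConst T Λ M * T * Real.exp (2 * (M * T)), 1 / (|M| + 1), by positivity, ?_⟩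
  intro γ hγ hγi hΛ φ hφ f hf _ Ω mΩ P hP ℱ N hN X₀ hX₀ Y U hY K hK hKδ y hy n hn
  have huniv : jumpMeasure γ univ = ENNReal.ofReal Λ := by rw [jumpMeasure_univ hγ hγi, hΛ]
  have hfin : IsFiniteMeasure (jumpMeasure γ) := ⟨by rw [huniv]; exact ENNReal.ofReal_lt_top⟩
  have hΛ0 : 0 ≤ Λ := hΛ ▸ integral_nonneg hγ
  have hreal : (jumpMeasure γ).real univ = Λ := by
    rw [measureReal_def, huniv, ENNReal.toReal_ofReal hΛ0]
  have hfr := hf.isRegularGenerator hT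
  have hφc : Continuous φ := continuousOn_univ.1 hφ.1.continuousOn
  obtain ⟨u, w, hu⟩ := exists_isBackwardSolution (jumpMeasure γ) hT.le hfr hφc
    (fun x => hφ.norm_le (mem_univ x))
  have hMK : M * (T / K) ≤ 1 := by
    have h1 : 0 ≤ T / K := by positivity
    calc M * (T / K) ≤ (|M| + 1) * (1 / (|M| + 1)) :=
          mul_le_mul ((le_abs_self M).trans (by linarith)) hKδ h1 (by positivity)
      _ = 1 := by field_simp
  have hN' : IsPoissonRandomMeasureFor ℱ N (timeJump T (jumpMeasure γ)) P := hN
  have ht := gridTime_mem_Icc hT.le hK hn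
  set t := gridTime T K n with htdef
  have hident := hY.ae_eq hN' hX₀ hT.le hfr hu t ht
  have hXt : Measurable (forwardProcess X₀ N t) :=
    (hN'.measurable_forwardProcess hX₀ ⟨t, ht.1⟩).mono (ℱ.le _) le_rfl
  -- The bound is uniform in `x`, hence almost sure along the forward process; integrability and the
  -- estimate in mean both follow.
  have hbound : ∀ᵐ ω ∂P, ‖Y t ω - y n (forwardProcess X₀ N t ω)‖ ≤
      2 * truncationConst T Λ M * T * Real.exp (2 * (M * T)) * (T / K) ^ 2 := by
    filter_upwards [hident] with ω hω
    rw [hω, Real.norm_eq_abs, ← hreal]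
    exact IsThetaScheme.abs_sub_le hN' hT.le hfr hu hK hMK hy hn _
  have hint : Integrable (fun ω => Y t ω - y n (forwardProcess X₀ N t ω)) P :=
    Integrable.of_bound
      ((hY.measurable ht).sub ((hy.measurable n hn).comp hXt)).aestronglyMeasurable
      _ hbound
  refine ⟨hint, ?_⟩
  calc _ ≤ ∫ _, 2 * truncationConst T Λ M * T * Real.exp (2 * (M * T)) * (T / K) ^ 2 ∂P :=
        integral_mono_ae hint.abs (integrable_const _) hbound
    _ = _ := by simp
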